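/- **Setting.** Let $V=\{v_0,\dots,v_{n-1}\}$ be observable variables and let $\mathcal G=\mathcal G(V\cup L,E\cup E_L)$ be a causal graph: $E\subseteq V\times V$ is acyclic (the *observable graph* $G=(V,E)$), every latent in $L$ has no parents and exactly two children, both in $V$, and any pair of observables has at most one latent $l_{ij}$ in common. For $v\in V$ let $\mathrm{Pa}(v)$ be its set of observable parents and $\mathrm{Anc}(v)$ the set of observables with a directed path of positive length to $v$. An observable $v_k$ is a *$p$-collider* for $v_i,v_j$ if some (simple, undirected) path of $\mathcal G$ between $v_i$ and $v_j$ has the form $v_i\cdots\to v_k\leftarrow\cdots v_j$ and $v_k$ belongs to, or has a descendant in, $\mathrm{Pa}(v_i)\cup\mathrm{Pa}(v_j)$. $\mathcal G$ is *$\tau$-causal* if every pair of distinct observables has at most $\tau$ $p$-colliders. Assume $\tau\le n-2$ (every causal graph is $(n-2)$-causal), so $n\ge 2$, and that $\tau$ is known to the algorithms. All variables have finite domains, and their joint law factorizes along $\mathcal G$ (causal Markov condition). The intervention $\mathrm{do}(S)$, $S\subseteq V$, replaces the mechanisms of the variables in $S$ by independent draws from fixed laws of full support. Let $\mathcal G_{\overline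 S}$ be $\mathcal G$ with the arrows into $S$ deleted. Assume * *faithfulness* of all observational and interventional distributions: if $i\ne j$, $Z\subseteq V\setminus\{v_i,v_j\}$ and $v_i\perp v_j\mid Z$ under $\mathrm{do}(S)$, then $v_i,v_j$ are d-separated by $Z$ in $\mathcal G_{\overline S}$; * *do-see faithfulness* (the exclusion of pathological coincidences in distribution tests): if $i\neq j$, $Z\subseteq V\setminus\{v_i,v_j\}$, $v_i,v_j\notin S$ and $\Pr[v_j\mid v_i,Z,\mathrm{do}(S)]=\Pr[v_j\mid Z,\mathrm{do}(S\cup\{v_i\})]$, then $v_i,v_j$ are d-separated by $Z$ in $\mathcal G_{\overline S}$ with the arrows out of $v_i$ deleted. The *CI-oracle* answers, for $v_i,v_j\in V$ and $Z,S\subseteq V$, whether $v_i\perp v_j\mid Z$ under $\mathrm{do}(S)$. The *DT-oracle* answers whether $\Pr[v_j\mid v_i,Z,\mathrm{do}(S)]$ and $\Pr[v_j\mid Z,\mathrm{do}(S\cup\{v_i\})]$ are identical, the value at which $v_i$ is observed in the first being the one it is set to in the second (conditional probabilities are compared wherever both are defined). **Algorithms.** Let $\tau'=\max\{\tau,2\}$.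 Before any query, draw random collections $\mathcal A,\mathcal B$ of $\lceil 72\,\tau'\ln n\rceil$ subsets of $V$ each and $\mathcal D$ of $\lceil 24\,\tau'^2\ln n\rceil$ subsets, every set including every observable independently with probability $1-1/\tau'$. Let $\mathcal S$ be the strongly separating system of the $2\lceil\log_2 n\rceil$ sets $\{v_a:\text{the }k\text{-th binary digit of }a\text{ is }b\}$. 1. *Ancestral graph:* take the transitive closure of the relation "$v_i\not\perp v_j$ under $\mathrm{do}(S)$ for some $S\in\mathcal S$ with $v_i\in S$, $v_j\notin S$". 2. *RecoverG:* declare $v_i\to v_j$ if $v_i$ is a recovered ancestor of $v_j$ and, for all $A\in\mathcal A$ with $v_i\in A$, $v_j\notin A$, $v_i\not\perp v_j\mid \mathrm{Anc}(v_j)\setminus\{v_i\}$ under $\mathrm{do}(A)$ (with $\mathrm{Anc}$ as recovered in step 1). 3. *LatentsNEdges:* for every pair $v_i,v_j$ that is non-adjacent in the recovered observable graph, declare a latent $l_{ij}$ if $v_i\not\perp v_j\mid\mathrm{Pa}(v_i)\cup\mathrm{Pa}(v_j)$ under $\mathrm{do}(D)$ for all $D\in\mathcal D$ with $v_i,v_j\notin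 D$. 4. *LatentsWEdges:* for every recovered edge $v_i\to v_j$, declare a latent $l_{ij}$ if for all $B\in\mathcal B$ with $v_i\in B$, $v_j\notin B$, setting $B'=B\setminus\{v_i\}$, $\Pr[v_j\mid v_i,\mathrm{Pa}(v_j),\mathrm{do}(\mathrm{Pa}(v_i)\cup B')]\ne\Pr[v_j\mid\mathrm{Pa}(v_j),\mathrm{do}(\{v_i\}\cup\mathrm{Pa}(v_i)\cup B')]$. In steps 3 and 4, $\mathrm{Pa}$ refers to the graph recovered in step 2. **Theorem.** There is a universal constant $C$ such that, for all $n$, $\tau$, $\mathcal G$ and models as above, * for every outcome of the random draws, the algorithms use at most $C\,(n\tau\ln n+n\ln n)$ interventions in total, and their output depends only on the oracles' answers to queries on these interventions; * with probability at least $1-C/n^2$ over the random draws, the output is $\mathcal G$, latents included. -/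

import Mathlib

open Finset MeasureTheory ProbabilityTheory

namespace CausalRecovery

noncomputable section

/-! ### d-separation in directed graphs -/

/-- `R a b` means that there is an arrow `a → b`. A path (that is, a sequence of vertices in which
consecutive ones are joined by an arrow in one of the two directions) is blocked by `Z` if it
passes through a vertex `b` that is
* not a collider on the path and belongs to `Z`, or
* a collider on the path such that neither `b` nor any descendant of `b` belongs to `Z`. -/
def IsBlocked {N : Type*} (R : N → N → Prop) (Z : Set N) (p : List N) : Prop :=
  ∃ a b c : N, [a, b, c] <:+: p ∧
    ((¬ (R a b ∧ R c b) ∧ b ∈ Z) ∨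
      ((R a b ∧ R c b) ∧ ∀ d, Relation.ReflTransGen R b d → d ∉ Z))

/-- `x` and `y` are d-separated by `Z`: every (simple, undirected) path between them is blocked. -/
def DSep {N : Type*} (R : N → N → Prop) (x y : N) (Z : Set N) : Prop :=
  ∀ p : (SimpleGraph.fromRel R).Walk x y, p.IsPath → IsBlocked R Z p.support

/-! ### Causal graphs with latents -/

/-- The combinatorial data of a causal graph on the observables `Fin n`: the arrows between
observables, and the latents. As every latent has exactly two children, both observable, and no
parents, a latent is recorded as the unordered pair of its children. -/
@[ext] structure LatentGraph (n : ℕ) where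
  edges : Finset (Fin n × Fin n)
  latents : Finset (Sym2 (Fin n))

namespace LatentGraph

variable {n : ℕ} (G : LatentGraph n)

/-- Causal graphs: the observable graph is acyclic, and the two children of a latent are
distinct. -/
def IsCausal : Prop :=
  (∀ v, ¬ Relation.TransGen (fun a b => (a, b) ∈ G.edges) v v) ∧ ∀ e ∈ G.latents, ¬ e.IsDiag

/-- The vertices `V ∪ L` of the whole causal graph. -/
abbrev Node : Type := Fin n ⊕ {e : Sym2 (Fin n) // e ∈ G.latents}

/-- The arrows of the whole causal graph. -/
def Arrow : G.Node → G.Node → Prop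
  | Sum.inl a, Sum.inl b => (a, b) ∈ G.edges
  | Sum.inr e, Sum.inl b => b ∈ e.1
  | _, Sum.inr _ => False

/-- A set of observables as a set of vertices of the whole graph. -/
def obs (S : Finset (Fin n)) : Set G.Node := Sum.inl '' (S : Set (Fin n))

/-- The mutilated graph of the intervention `do(S)`: all arrows into `S` are deleted. -/
def ArrowDo (S : Finset (Fin n)) (x y : G.Node) : Prop := G.Arrow x y ∧ y ∉ G.obs S

/-- The mutilated graph of `do(S)` with, in addition, all arrows out of the observable `i`
deleted. -/
def ArrowDoCut (S : Finset (Fin n)) (i : Fin n) (x y : G.Node) : Prop :=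
  G.ArrowDo S x y ∧ x ≠ Sum.inl i

/-- `k` is a `p`-collider for the pair `i, j`: it is a collider on some path between `i` and `j`
in the whole graph, and it is, or has a descendant that is, an observable parent of `i` or `j`. -/
def IsPCollider (i j k : Fin n) : Prop :=
  (∃ p : (SimpleGraph.fromRel G.Arrow).Walk (Sum.inl i) (Sum.inl j), p.IsPath ∧
    ∃ a c : G.Node, [a, Sum.inl k, c] <:+: p.support ∧
      G.Arrow a (Sum.inl k) ∧ G.Arrow c (Sum.inl k)) ∧
  ∃ m, Relation.ReflTransGen (fun a b => (a, b) ∈ G.edges) k m ∧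
    ((m, i) ∈ G.edges ∨ (m, j) ∈ G.edges)

/-- At most `τ` `p`-colliders for every pair of distinct observables. -/
def IsTauCausal (τ : ℕ) : Prop :=
  ∀ i j : Fin n, i ≠ j → {k | G.IsPCollider i j k}.ncard ≤ τ

end LatentGraph

/-! ### Causal models, interventional distributions and the oracles -/

/-- A causal model over a causal graph, all variables having finite domains. -/
structure CausalModel {n : ℕ} (G : LatentGraph n) where
  /-- the number of values of each variable -/
  card : G.Node → ℕ
  card_pos : ∀ x, 0 < card x
  /-- `mech x w a` is the probability that `x` takes the value `a` when its parents take the values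
  that the assignment `w` gives them -/
  mech : (x : G.Node) → ((y : G.Node) → Fin (card y)) → Fin (card x) → ℝ
  mech_nonneg : ∀ x w a, 0 ≤ mech x w a
  mech_sum : ∀ x w, ∑ a, mech x w a = 1
  mech_local : ∀ x w w', (∀ y, G.Arrow y x → w y = w' y) → mech x w = mech x w'
  /-- the law from which the value of an observable is drawn when it is intervened on -/
  rnd : (v : Fin n) → Fin (card (Sum.inl v)) → ℝ
  rnd_pos : ∀ v a, 0 < rnd v a
  rnd_sum : ∀ v, ∑ a, rnd v a = 1

namespace CausalModel

variable {n : ℕ} {G : LatentGraph n} (M : CausalModel G)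

/-- Joint assignments of values to all variables, observable and latent. -/
abbrev Assignment : Type := (x : G.Node) → Fin (M.card x)

/-- The truncated factorization: the probability of the assignment `w` under `do(S = s)`, where
`s` is the restriction of `w` to `S` (assignments that disagree with `s` have probability `0`). -/
def doLaw (S : Finset (Fin n)) (w : M.Assignment) : ℝ :=
  (∏ v ∈ Sᶜ, M.mech (Sum.inl v) w (w (Sum.inl v))) *
    ∏ e : {e : Sym2 (Fin n) // e ∈ G.latents}, M.mech (Sum.inr e) w (w (Sum.inr e))

/-- The interventional distribution of `do(S)`, the values of the variables in `S` being
drawn independently from the laws `rnd`. -/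
def law (S : Finset (Fin n)) (w : M.Assignment) : ℝ :=
  (∏ v ∈ S, M.rnd v (w (Sum.inl v))) * M.doLaw S w

open Classical in
/-- The probability under `do(S)` that the observables in `X` take the values that `w` gives
them. -/
def prob (S X : Finset (Fin n)) (w : M.Assignment) : ℝ :=
  ∑ w' : M.Assignment with ∀ v ∈ X, w' (Sum.inl v) = w (Sum.inl v), M.law S w'

/-- `i` and `j` are conditionally independent given `Z` under `do(S)`. -/
def CondIndep (i j : Fin n) (Z S : Finset (Fin n)) : Prop :=
  ∀ w : M.Assignment, M.prob S (insert i (insert j Z)) w * M.prob S Z w =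
    M.prob S (insert i Z) w * M.prob S (insert j Z) w

/-- The conditional distributions `Pr[j ∣ i, Z, do(S)]` and `Pr[j ∣ Z, do(S ∪ {i})]` are identical,
the value at which `i` is observed in the former being the one assigned to it in the latter (written
without denominators: equality wherever both sides are defined). -/
def DoSeeEq (i j : Fin n) (Z S : Finset (Fin n)) : Prop :=
  ∀ w : M.Assignment,
    M.prob S (insert j (insert i Z)) w * M.prob (insert i S) (insert i Z) w =
      M.prob (insert i S) (insert j (insert i Z)) w * M.prob S (insert i Z) w

/-- Faithfulness of all interventional distributions of the observables (the observational one
included): every conditional independence comes from a d-separation in the mutilated graph. -/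
def IsFaithful : Prop :=
  ∀ (i j : Fin n) (Z S : Finset (Fin n)), i ≠ j → i ∉ Z → j ∉ Z → M.CondIndep i j Z S →
    DSep (G.ArrowDo S) (Sum.inl i) (Sum.inl j) (G.obs Z)

/-- Faithfulness for do-see comparisons: `Pr[j ∣ i, Z, do(S)]` and `Pr[j ∣ Z, do(S ∪ {i})]`
are identical only if the graph forces it, that is, only if `i` and `j` are d-separated by `Z` after
deleting the arrows into `S` and out of `i`. -/
def IsDoSeeFaithful : Prop :=
  ∀ (i j : Fin n) (Z S : Finset (Fin n)), i ≠ j → i ∉ Z → j ∉ Z → i ∉ S → j ∉ S →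
    M.DoSeeEq i j Z S → DSep (G.ArrowDoCut S i) (Sum.inl i) (Sum.inl j) (G.obs Z)

end CausalModel

/-- The answers to all possible queries. The last argument is the intervention set. -/
structure Oracles (n : ℕ) where
  /-- CI-oracle: are `i` and `j` independent given `Z` under `do(S)`? -/
  ci : (i j : Fin n) → (Z S : Finset (Fin n)) → Prop
  /-- DT-oracle: are `Pr[j ∣ i, Z, do(S)]` and `Pr[j ∣ Z, do(S ∪ {i})]` identical? -/
  dt : (i j : Fin n) → (Z S : Finset (Fin n)) → Prop

/-- The CI- and DT-oracles of a causal model. -/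
def CausalModel.oracles {n : ℕ} {G : LatentGraph n} (M : CausalModel G) : Oracles n where
  ci := M.CondIndep
  dt := M.DoSeeEq

/-- The two oracles give the same answers to all queries whose intervention sets belong to `I`. -/
def Oracles.AgreeOn {n : ℕ} (I : Finset (Finset (Fin n))) (O O' : Oracles n) : Prop :=
  ∀ (i j : Fin n) (Z S : Finset (Fin n)), S ∈ I →
    (O.ci i j Z S ↔ O'.ci i j Z S) ∧ (insert i S ∈ I → (O.dt i j Z S ↔ O'.dt i j Z S))

/-! ### The algorithms -/

/-- The strongly separating set system given by the binary digits of the labels. -/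
def sepSystem (n : ℕ) : Finset (Finset (Fin n)) :=
  (range (Nat.clog 2 n) ×ˢ (univ : Finset Bool)).image
    fun kb => univ.filter fun v : Fin n => (v : ℕ).testBit kb.1 = kb.2

/-- The recovered ancestral graph: the transitive closure of the relation "`i` and `j` are dependent
under `do(S)` for a set `S` of the separating system that contains `i` and not `j`". -/
def recoverAnc {n : ℕ} (O : Oracles n) : Fin n → Fin n → Prop :=
  Relation.TransGen fun i j => ∃ S ∈ sepSystem n, i ∈ S ∧ j ∉ S ∧ ¬ O.ci i j ∅ S

open Classical in
/-- `RecoverG`, run on an ancestral graph `anc` and a collection `A` of intervention sets. -/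
def recoverG {n : ℕ} (O : Oracles n) (anc : Fin n → Fin n → Prop) (A : Finset (Finset (Fin n))) :
    Finset (Fin n × Fin n) :=
  univ.filter fun (i, j) => anc i j ∧
    ∀ S ∈ A, i ∈ S → j ∉ S → ¬ O.ci i j ((univ.filter fun k => anc k j).erase i) S

/-- The parents of `j` in the observable graph with arrows `E`. -/
def parents {n : ℕ} (E : Finset (Fin n × Fin n)) (j : Fin n) : Finset (Fin n) :=
  univ.filter fun i => (i, j) ∈ E

open Classical in
/-- `LatentsNEdges`: the latents found between non-adjacent observables. -/
def latentsNEdges {n : ℕ} (O : Oracles n) (E : Finset (Fin n × Fin n))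
    (D : Finset (Finset (Fin n))) : Finset (Sym2 (Fin n)) :=
  (univ.filter fun ((i, j) : Fin n × Fin n) => i < j ∧ (i, j) ∉ E ∧ (j, i) ∉ E ∧
    ∀ S ∈ D, i ∉ S → j ∉ S → ¬ O.ci i j (parents E i ∪ parents E j) S).image
      fun (i, j) => s(i, j)

open Classical in
/-- `LatentsWEdges`: the latents found between adjacent observables. -/
def latentsWEdges {n : ℕ} (O : Oracles n) (E : Finset (Fin n × Fin n))
    (B : Finset (Finset (Fin n))) : Finset (Sym2 (Fin n)) :=
  (E.filter fun (i, j) =>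
    ∀ S ∈ B, i ∈ S → j ∉ S → ¬ O.dt i j (parents E j) (parents E i ∪ S.erase i)).image
      fun (i, j) => s(i, j)

/-- The three algorithms put together: the recovered causal graph. -/
def recoverGraph {n : ℕ} (O : Oracles n) (A D B : Finset (Finset (Fin n))) : LatentGraph n :=
  let E := recoverG O (recoverAnc O) A
  ⟨E, latentsNEdges O E D ∪ latentsWEdges O E B⟩

/-- The intervention sets used along the way: the separating system, `A`, `D`, and
the two sets `Pa(i) ∪ (S ∖ {i})`, `{i} ∪ Pa(i) ∪ (S ∖ {i})` for every observable `i` and every `S`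
in `B`, with `Pa` the parents in the observable graph returned by `RecoverG`. -/
def interventions {n : ℕ} (O : Oracles n) (A D B : Finset (Finset (Fin n))) :
    Finset (Finset (Fin n)) :=
  let E := recoverG O (recoverAnc O) A
  sepSystem n ∪ A ∪ D ∪
    (univ ×ˢ B).image (fun (i, S) => parents E i ∪ S.erase i) ∪
    (univ ×ˢ B).image (fun (i, S) => insert i (parents E i ∪ S.erase i))

/-! ### The random intervention sets -/

/-- `τ' = max {τ, 2}`. -/
def tauMax (τ : ℕ) : ℕ := max τ 2

/-- The number of random sets drawn for `RecoverG`, and for `LatentsWEdges`. -/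
def numEdgeSets (n τ : ℕ) : ℕ := ⌈72 * (tauMax τ : ℝ) * Real.log n⌉₊

/-- The number of random sets drawn for `LatentsNEdges`. -/
def numNonEdgeSets (n τ : ℕ) : ℕ := ⌈24 * (tauMax τ : ℝ) ^ 2 * Real.log n⌉₊

/-- The indices of all random sets: those for `RecoverG`, for `LatentsNEdges`, and for
`LatentsWEdges`. -/
abbrev SetIndex (n τ : ℕ) : Type :=
  Fin (numEdgeSets n τ) ⊕ Fin (numNonEdgeSets n τ) ⊕ Fin (numEdgeSets n τ)

/-- The sample space: for every random set and every observable, whether it is included. -/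
abbrev Sample (n τ : ℕ) : Type := SetIndex n τ × Fin n → Bool

/-- The inclusion probability `1 - 1/τ'`. -/
def inclusionProb (τ : ℕ) : unitInterval :=
  ⟨1 - 1 / (tauMax τ : ℝ), by
    have h : (1 : ℝ) ≤ tauMax τ := by
      exact_mod_cast (show 1 ≤ tauMax τ from le_trans (by norm_num) (le_max_right τ 2))
    have h0 : (0 : ℝ) ≤ 1 / (tauMax τ : ℝ) := by positivity
    have h1 : 1 / (tauMax τ : ℝ) ≤ 1 := by rw [div_le_one (by linarith)]; exact h
    exact ⟨by linarith, by linarith⟩⟩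

/-- All inclusions are independent and have probability `1 - 1/τ'`. -/
def sampleLaw (n τ : ℕ) : Measure (Sample n τ) :=
  Measure.pi fun _ => bernoulliMeasure true false (inclusionProb τ)

/-- The random set with index `t`. -/
def randomSet {n τ : ℕ} (ω : Sample n τ) (t : SetIndex n τ) : Finset (Fin n) :=
  univ.filter fun v => ω (t, v) = true

/-- The random collection for `RecoverG`. -/
def collA {n τ : ℕ} (ω : Sample n τ) : Finset (Finset (Fin n)) :=
  univ.image fun t => randomSet ω (Sum.inl t)

/-- The random collection for `LatentsNEdges`. -/
def collD {n τ : ℕ} (ω : Sample n τ) : Finset (Finset (Fin n)) :=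
  univ.image fun t => randomSet ω (Sum.inr (Sum.inl t))

/-- The random collection for `LatentsWEdges`. -/
def collB {n τ : ℕ} (ω : Sample n τ) : Finset (Finset (Fin n)) :=
  univ.image fun t => randomSet ω (Sum.inr (Sum.inr t))

end

end CausalRecovery

/-!
The proof has a structural and a probabilistic half.

**Structure.** Every interventional law factorizes along its mutilated graph, so d-separation
implies conditional independence (`marg_mul_marg_of_dSep`). This is proved by passing to the
ancestral set of `x`, `y`, `Z`, where the law is a product of weights, each of which depends on a
clique of the moral graph. If `U` is the component of `y` in that graph after removing `Z`, then
exchanging the coordinates in `U` between two assignments that agree on `Z` preserves the product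
of their weights, and this bijection is conditional independence. That `x` is not in `U` is
`not_moral_reach_of_dSep`: a path in the moral graph yields an active walk between `x` and `y`, and
cutting out the loops yields an active path. The comparison of observing and setting `i`
(`CausalModel.doSeeEq_of_dSep`) is the same statement for the model in which the children of `i`
receive a constant in place of its value, which factorizes along the graph without the arrows out
of `i`.

With faithfulness, the answer to every query of the algorithms is thus read off the graph. An edge
or a latent always leaves an active path. In its absence, let the intervention set contain all
`p`-colliders of the pair `i`, `j`. A collider on an active path has a descendant in the
conditioning set. If this set consists of parents of `i` and `j`, then the collider is a
`p`-collider, which is impossible because a vertex intervened on has no incoming arrows; if it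
consists of the ancestors of `j`, the same applies to a suitable collider near the end of the path.
The paths that remain are blocked by the parents or ancestors in the conditioning set
(`LatentGraph.dSep_ancestors`, `LatentGraph.dSep_parents`, `LatentGraph.dSep_cut`). Hence the
output is correct as soon as each collection has, for each pair, a set that contains the at most
`τ` `p`-colliders and meets the pair in the prescribed way (`recoverGraph_eq`).

**Probability.** As `(1 - 1/τ') ^ τ' ≥ 1/4`, a random set is good for a given pair with probability
at least `1 / (8 τ')`, or `1 / (4 τ' ^ 2)` if it has to avoid both members of the pair. The sets
are independent, so all of them fail with probability at most `n⁻⁴`, and a union bound over the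
pairs and the three collections concludes (`one_sub_le_measureReal_good`).
-/

namespace CausalRecovery

/-! ### Active walks -/

section ActiveWalks

variable {N : Type*} {R : N → N → Prop} {Z : Set N}

/-- The consecutive vertices `a, b, c` of a path block it at `b`. -/
def Blocks (R : N → N → Prop) (Z : Set N) (a b c : N) : Prop :=
  (¬ (R a b ∧ R c b) ∧ b ∈ Z) ∨ ((R a b ∧ R c b) ∧ ∀ d, Relation.ReflTransGen R b d → d ∉ Z)

/-- The sequence `w 0, …, w m` is a walk, possibly with repeated vertices, that is not blocked
by `Z`. -/
structure IsActiveWalk (R : N → N → Prop) (Z : Set N) (m : ℕ) (w : ℕ → N) : Prop where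
  adj : ∀ k < m, R (w k) (w (k + 1)) ∨ R (w (k + 1)) (w k)
  not_blocks : ∀ k, k + 2 ≤ m → ¬ Blocks R Z (w k) (w (k + 1)) (w (k + 2))

theorem infix_map_range_iff {m : ℕ} {w : ℕ → N} {a b c : N} :
    [a, b, c] <:+: (List.range (m + 1)).map w ↔
      ∃ k, k + 2 ≤ m ∧ a = w k ∧ b = w (k + 1) ∧ c = w (k + 2) := by
  constructor
  · rintro ⟨s, t, h⟩
    have hl := congrArg List.length h
    simp at hl
    have key : ∀ i < 3, ([a, b, c] : List N)[i]? = some (w (s.length + i)) := by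
      intro i hi
      have h2 := congrArg (fun l => l[s.length + i]?) h
      simp only [List.append_assoc] at h2
      rw [List.getElem?_append_right (by omega), List.getElem?_append_left (by simp; omega)] at h2
      simpa [List.getElem?_range (show s.length + i < m + 1 by omega)] using h2
    refine ⟨s.length, by omega, ?_, ?_, ?_⟩
    · simpa using key 0 (by norm_num)
    · simpa using key 1 (by norm_num)
    · simpa using key 2 (by norm_num)
  · rintro ⟨k, hk, rfl, rfl, rfl⟩
    obtain ⟨r, rfl⟩ := Nat.exists_eq_add_of_le hk
    have : List.range (k + 2 + r + 1) =
        List.range k ++ [k, k + 1, k + 2] ++ (List.range r).map (k + 3 + ·) := by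
      rw [show k + 2 + r + 1 = k + 3 + r by omega, List.range_add]
      simp [List.range_succ]
    rw [this]
    exact ⟨(List.range k).map w, ((List.range r).map (k + 3 + ·)).map w, by simp⟩

theorem support_eq_map_getVert {G : SimpleGraph N} {x y : N} (p : G.Walk x y) :
    p.support = (List.range (p.length + 1)).map p.getVert := by
  induction p with
  | nil => simp
  | cons h p ih =>
    rw [SimpleGraph.Walk.support_cons, SimpleGraph.Walk.length_cons, List.range_succ_eq_map, ih]
    simp [Function.comp_def]

/-- A sequence of distinct vertices, consecutive ones being joined by an arrow, is a path. -/
theorem exists_isPath (m : ℕ) (w : ℕ → N)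
    (hadj : ∀ k < m, R (w k) (w (k + 1)) ∨ R (w (k + 1)) (w k))
    (hinj : Set.InjOn w (Set.Iic m)) :
    ∃ p : (SimpleGraph.fromRel R).Walk (w 0) (w m), p.IsPath ∧
      p.support = (List.range (m + 1)).map w := by
  suffices h : ∃ p : (SimpleGraph.fromRel R).Walk (w 0) (w m),
      p.support = (List.range (m + 1)).map w by
    obtain ⟨p, hp⟩ := h
    refine ⟨p, ?_, hp⟩
    rw [SimpleGraph.Walk.isPath_def, hp]
    refine List.Nodup.map_on ?_ List.nodup_range
    intro a ha b hb hab
    rw [List.mem_range] at ha hb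
    exact hinj (Set.mem_Iic.2 (by omega)) (Set.mem_Iic.2 (by omega)) hab
  induction m generalizing w with
  | zero => exact ⟨.nil, by simp⟩
  | succ m ih =>
    obtain ⟨p, hp⟩ := ih (fun k => w (k + 1)) (fun k hk => hadj (k + 1) (by omega))
      (fun a ha b hb hab => by
        have := hinj (Set.mem_Iic.2 (Nat.succ_le_succ ha)) (Set.mem_Iic.2 (Nat.succ_le_succ hb)) hab
        omega)
    have h01 : (SimpleGraph.fromRel R).Adj (w 0) (w (0 + 1)) := by
      rw [SimpleGraph.fromRel_adj]
      refine ⟨fun h => ?_, hadj 0 (by omega)⟩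
      have := hinj (Set.mem_Iic.2 (by omega)) (Set.mem_Iic.2 (by omega)) h
      omega
    refine ⟨.cons h01 p, ?_⟩
    rw [SimpleGraph.Walk.support_cons, hp, List.range_succ_eq_map (n := m + 1)]
    simp [Function.comp_def]

/-- d-separation in terms of active walks without repeated vertices. -/
theorem dSep_iff {x y : N} :
    DSep R x y Z ↔ ∀ m w, IsActiveWalk R Z m w → Set.InjOn w (Set.Iic m) → w 0 = x → w m ≠ y := by
  constructor
  · rintro h m w hw hinj rfl rfl
    obtain ⟨p, hp, hs⟩ := exists_isPath m w hw.adj hinj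
    obtain ⟨a, b, c, hi, hb⟩ := h p hp
    rw [hs, infix_map_range_iff] at hi
    obtain ⟨k, hk, rfl, rfl, rfl⟩ := hi
    exact hw.not_blocks k hk hb
  · intro h p hp
    by_contra hb
    refine h p.length p.getVert ⟨fun k hk => ?_, fun k hk hbk => hb ?_⟩ hp.getVert_injOn (by simp)
      (by simp)
    · exact ((SimpleGraph.fromRel_adj _ _ _).1 (p.adj_getVert_succ hk)).2
    · exact ⟨_, _, _, by rw [support_eq_map_getVert, infix_map_range_iff]; exact
        ⟨k, hk, rfl, rfl, rfl⟩, hbk⟩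

theorem not_rel_symm (hR : ∀ v, ¬ Relation.TransGen R v v) {a b : N} (h : R a b) : ¬ R b a :=
  fun h' => hR a (.tail (.single h) h')

/-- Loops can be cut out of active walks. A vertex that becomes a collider on the shorter walk was a
collider before, or the loop leaves it along an arrow; in the latter case it is an ancestor of
the first collider on the loop, which exists by acyclicity. -/
theorem IsActiveWalk.exists_injOn (hR : ∀ v, ¬ Relation.TransGen R v v) {m : ℕ} {w : ℕ → N}
    (hw : IsActiveWalk R Z m w) :
    ∃ m' w', IsActiveWalk R Z m' w' ∧ Set.InjOn w' (Set.Iic m') ∧ w' 0 = w 0 ∧ w' m' = w m := by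
  induction m using Nat.strong_induction_on generalizing w with
  | _ m ih =>
  by_cases hinj : Set.InjOn w (Set.Iic m)
  · exact ⟨m, w, hw, hinj, rfl, rfl⟩
  obtain ⟨s, t, hst, htm, heq⟩ : ∃ s t, s < t ∧ t ≤ m ∧ w s = w t := by
    simp only [Set.InjOn, not_forall] at hinj
    obtain ⟨a, ha, b, hb, hab, hne⟩ := hinj
    rw [Set.mem_Iic] at ha hb
    rcases lt_or_gt_of_ne hne with h | h
    · exact ⟨a, b, h, hb, hab⟩
    · exact ⟨b, a, h, ha, hab.symm⟩
  let w' : ℕ → N := fun k => if k ≤ s then w k else w (k + (t - s))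
  have hle : ∀ k, k ≤ s → w' k = w k := fun k hk => if_pos hk
  have hge : ∀ k, s ≤ k → w' k = w (k + (t - s)) := by
    intro k hk
    rcases hk.eq_or_lt with rfl | h
    · rw [hle _ le_rfl, heq]; congr 1; omega
    · exact if_neg (by omega)
  have hw' : IsActiveWalk R Z (m - (t - s)) w' := by
    constructor
    · intro k hk
      rcases lt_or_ge k s with h | h
      · rw [hle k h.le, hle (k + 1) h]; exact hw.adj k (by omega)
      · rw [hge k h, hge (k + 1) (by omega), show k + 1 + (t - s) = k + (t - s) + 1 by omega]
        exact hw.adj _ (by omega)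
    · intro k hk hb
      rcases lt_trichotomy (k + 1) s with h | h | h
      · rw [hle k (by omega), hle (k + 1) h.le, hle (k + 2) h] at hb
        exact hw.not_blocks k (by omega) hb
      · subst h
        rw [hle k (by omega), hle (k + 1) le_rfl, hge (k + 2) (by omega)] at hb
        have h1 := hw.not_blocks k (by omega)
        have h2 := hw.not_blocks (t - 1) (by omega)
        rw [show t - 1 + 1 = t by omega, show t - 1 + 2 = t + 1 by omega, ← heq] at h2
        rw [show k + 2 + (t - (k + 1)) = t + 1 by omega] at hb
        rcases hb with ⟨hnc, hz⟩ | ⟨⟨ha, hc⟩, hd⟩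
        · by_cases ha : R (w k) (w (k + 1))
          · exact h2 (Or.inl ⟨fun h => hnc ⟨ha, h.2⟩, hz⟩)
          · exact h1 (Or.inl ⟨fun h => ha h.1, hz⟩)
        · -- The loop would be a directed cycle, as it contains no collider.
          have key : ∀ j, k + 1 + j < t → R (w (k + 1 + j)) (w (k + 1 + j + 1)) ∧
              Relation.TransGen R (w (k + 1)) (w (k + 1 + j + 1)) := by
            intro j
            induction j with
            | zero =>
              intro _
              have : R (w (k + 1)) (w (k + 1 + 1)) :=
                (hw.adj (k + 1) (by omega)).resolve_right
                  fun h' => h1 (Or.inr ⟨⟨ha, h'⟩, hd⟩)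
              exact ⟨this, .single this⟩
            | succ j ihj =>
              intro hj
              obtain ⟨hr, ht⟩ := ihj (by omega)
              have h3 := hw.not_blocks (k + 1 + j) (by omega)
              have : R (w (k + 1 + j + 1)) (w (k + 1 + j + 1 + 1)) :=
                (hw.adj (k + 1 + j + 1) (by omega)).resolve_right fun h' =>
                  h3 (Or.inr ⟨⟨hr, h'⟩, fun d hdd => hd d (ht.to_reflTransGen.trans hdd)⟩)
              exact ⟨this, ht.tail this⟩
          have := (key (t - (k + 2)) (by omega)).2
          rw [show k + 1 + (t - (k + 2)) + 1 = t by omega, ← heq] at this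
          exact hR _ this
      · rw [hge k (by omega), hge (k + 1) h.le, hge (k + 2) (by omega),
          show k + 1 + (t - s) = k + (t - s) + 1 by omega,
          show k + 2 + (t - s) = k + (t - s) + 2 by omega] at hb
        exact hw.not_blocks _ (by omega) hb
  obtain ⟨m', w'', h1, h2, h3, h4⟩ := ih (m - (t - s)) (by omega) hw'
  refine ⟨m', w'', h1, h2, by rw [h3, hle 0 (by omega)], ?_⟩
  rw [h4, hge _ (by omega)]
  congr 1
  omega

/-- Putting a vertex `u` in front of the sequence `w`. -/
def prepend (u : N) (w : ℕ → N) : ℕ → N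
  | 0 => u
  | k + 1 => w k

theorem IsActiveWalk.prepend {m : ℕ} {w : ℕ → N} (hw : IsActiveWalk R Z m w) {u : N}
    (hadj : R u (w 0) ∨ R (w 0) u) (hb : 0 < m → ¬ Blocks R Z u (w 0) (w 1)) :
    IsActiveWalk R Z (m + 1) (prepend u w) := by
  constructor
  · rintro (_ | k) hk
    · exact hadj
    · exact hw.adj k (by omega)
  · rintro (_ | k) hk
    · exact hb (by omega)
    · exact hw.not_blocks k (by omega)

/-- There is an active walk from `u` to `y`. -/
def DConn (R : N → N → Prop) (Z : Set N) (u y : N) : Prop :=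
  ∃ m w, IsActiveWalk R Z m w ∧ w 0 = u ∧ w m = y

theorem DConn.refl (y : N) : DConn R Z y y :=
  ⟨0, fun _ => y, ⟨fun _ h => absurd h (by omega), fun _ h => absurd h (by omega)⟩, rfl, rfl⟩

theorem not_dSep_of_dConn (hR : ∀ v, ¬ Relation.TransGen R v v) {x y : N} (h : DConn R Z x y) :
    ¬ DSep R x y Z := by
  obtain ⟨m, w, hw, rfl, rfl⟩ := h
  obtain ⟨m', w', h1, h2, h3, h4⟩ := hw.exists_injOn hR
  exact fun hs => dSep_iff.1 hs m' w' h1 h2 h3 h4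

theorem DConn.of_rel (hR : ∀ v, ¬ Relation.TransGen R v v) {v u y : N} (h : DConn R Z v y)
    (hv : v ∉ Z) (hvu : R v u) : DConn R Z u y := by
  obtain ⟨m, w, hw, rfl, rfl⟩ := h
  refine ⟨m + 1, prepend u w, hw.prepend (Or.inr hvu) ?_, rfl, rfl⟩
  rintro - (h | h)
  · exact hv h.2
  · exact not_rel_symm hR hvu h.1.1

theorem DConn.of_reflTransGen (hR : ∀ v, ¬ Relation.TransGen R v v) {v x y : N}
    (h : DConn R Z v y) (hvx : Relation.ReflTransGen R v x)
    (hv : ∀ d, Relation.ReflTransGen R v d → d ∉ Z) : DConn R Z x y := by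
  induction hvx using Relation.ReflTransGen.head_induction_on with
  | refl => exact h
  | head hab _ ih =>
    exact ih (h.of_rel hR (hv _ .refl) hab) fun d hd => hv d (.head hab hd)

/-- A directed path along which no vertex has a descendant in `Z` is active. -/
theorem exists_directed_isActiveWalk (hR : ∀ v, ¬ Relation.TransGen R v v) {v y : N}
    (hvy : Relation.ReflTransGen R v y) (hv : ∀ d, Relation.ReflTransGen R v d → d ∉ Z) :
    ∃ m w, IsActiveWalk R Z m w ∧ w 0 = v ∧ w m = y ∧ (0 < m → R v (w 1)) := by
  induction hvy using Relation.ReflTransGen.head_induction_on with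
  | refl =>
    exact ⟨0, fun _ => y, ⟨fun _ h => absurd h (by omega), fun _ h => absurd h (by omega)⟩,
      rfl, rfl, fun h => absurd h (by omega)⟩
  | head hab _ ih =>
    obtain ⟨m, w, hw, rfl, rfl, h1⟩ := ih fun d hd => hv d (.head hab hd)
    refine ⟨m + 1, CausalRecovery.prepend _ w, hw.prepend (Or.inl hab) ?_, rfl, rfl, fun _ => hab⟩
    rintro hm (h | h)
    · exact hv _ (.single hab) h.2
    · exact not_rel_symm hR (h1 hm) h.1.2

/-- The ancestors of `x`, of `y` and of `Z`, these vertices included. -/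
def ancSet (R : N → N → Prop) (x y : N) (Z : Set N) : Set N :=
  {v | ∃ d, (d = x ∨ d = y ∨ d ∈ Z) ∧ Relation.ReflTransGen R v d}

/-- An active walk from `v` to `y` can be extended against an arrow into `v`, or else there is an
active walk from `x` to `y`: if `v` has no descendant in `Z`, then the walk is rerouted, either by
following a directed path from `v` to `x`, or by replacing it with a directed path from `v`
to `y`. -/
theorem IsActiveWalk.extend_against (hR : ∀ v, ¬ Relation.TransGen R v v) {x y u : N} {m : ℕ}
    {w : ℕ → N} (hw : IsActiveWalk R Z m w) (hy : w m = y)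
    (hin : w 0 ∉ Z ∨ (0 < m ∧ R (w 1) (w 0))) (hu : R u (w 0)) (hanc : w 0 ∈ ancSet R x y Z) :
    DConn R Z u y ∨ DConn R Z x y := by
  by_cases hd : ∀ d, Relation.ReflTransGen R (w 0) d → d ∉ Z
  · obtain ⟨d, rfl | rfl | hdz, hwd⟩ := hanc
    · exact Or.inr (DConn.of_reflTransGen hR ⟨m, w, hw, rfl, hy⟩ hwd hd)
    · left
      obtain ⟨m', w', hw', h0, h1, h2⟩ := exists_directed_isActiveWalk hR hwd hd
      refine ⟨m' + 1, CausalRecovery.prepend u w', hw'.prepend (Or.inl (h0 ▸ hu)) ?_, rfl, h1⟩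
      rintro hm (h | h)
      · exact hd _ .refl (h0 ▸ h.2)
      · exact not_rel_symm hR (h2 hm) (h0 ▸ h.1.2)
    · exact absurd hdz (hd d hwd)
  · left
    refine ⟨m + 1, CausalRecovery.prepend u w, hw.prepend (Or.inl hu) ?_, rfl, hy⟩
    rintro hm (h | h)
    · rcases hin with h' | h'
      · exact h' h.2
      · exact h.1 ⟨hu, h'.2⟩
    · exact hd h.2

/-- Adjacency in the moral graph of the ancestral set of `x`, `y`, `Z`, with `Z` removed. -/
def MoralAdj (R : N → N → Prop) (x y : N) (Z : Set N) (u v : N) : Prop :=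
  (u ∈ ancSet R x y Z ∧ u ∉ Z) ∧ (v ∈ ancSet R x y Z ∧ v ∉ Z) ∧
    (R u v ∨ R v u ∨ ∃ c ∈ ancSet R x y Z, R u c ∧ R v c)

/-- If `x` and `y` are d-separated, then they lie in different components of the moral graph. -/
theorem not_moral_reach_of_dSep (hR : ∀ v, ¬ Relation.TransGen R v v) {x y : N}
    (hs : DSep R x y Z) : ¬ Relation.ReflTransGen (MoralAdj R x y Z) y x := by
  intro h
  suffices key : ∀ u, Relation.ReflTransGen (MoralAdj R x y Z) y u →
      DConn R Z u y ∨ DConn R Z x y by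
    exact not_dSep_of_dConn hR (by simpa using key x h) hs
  intro u hu
  induction hu with
  | refl => exact Or.inl (.refl y)
  | @tail a b _ hab ih =>
    rcases ih with ih | ih
    swap
    · exact Or.inr ih
    obtain ⟨⟨haA, haZ⟩, ⟨-, hbZ⟩, hr | hr | ⟨c, hc, hac, hbc⟩⟩ := hab
    · exact Or.inl (ih.of_rel hR haZ hr)
    · obtain ⟨m, w, hw, rfl, hy⟩ := ih
      exact hw.extend_against hR hy (Or.inl haZ) hr haA
    · obtain ⟨m, w, hw, rfl, hy⟩ := ih
      have hw' : IsActiveWalk R Z (m + 1) (CausalRecovery.prepend c w) := by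
        refine hw.prepend (Or.inr hac) ?_
        rintro - (h | h)
        · exact haZ h.2
        · exact not_rel_symm hR hac h.1.1
      exact hw'.extend_against hR hy (Or.inr ⟨by omega, hac⟩) hbc hc

end ActiveWalks

/-! ### The global Markov property -/

section Markov

open Function

variable {N : Type*} [Fintype N] [DecidableEq N] {β : N → Type*} [∀ v, Fintype (β v)]

/-- A factor `m` that is a probability distribution in the coordinate `v` may be summed out if
the other factor `g` and the range of summation do not depend on that coordinate. -/
theorem card_mul_sum_mul_eq_sum (v : N) (P : ((x : N) → β x) → Prop) [DecidablePred P]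
    (hP : ∀ w a, P (update w v a) ↔ P w) (g m : ((x : N) → β x) → ℝ)
    (hg : ∀ w a, g (update w v a) = g w) (hm : ∀ w, ∑ a, m (update w v a) = 1) :
    (Fintype.card (β v) : ℝ) * ∑ w with P w, g w * m w = ∑ w with P w, g w := by
  have h1 : ∑ q ∈ (univ.filter P) ×ˢ (univ : Finset (β v)), g q.1 * m q.1 =
      ∑ q ∈ (univ.filter P) ×ˢ (univ : Finset (β v)), g q.1 * m (update q.1 v q.2) := by
    refine sum_nbij' (fun q => (update q.1 v q.2, q.1 v)) (fun q => (update q.1 v q.2, q.1 v))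
      ?_ ?_ ?_ ?_ ?_ <;> rintro ⟨w, a⟩ h <;> simp_all
  rw [sum_product, sum_product] at h1
  simp only [sum_const, ← mul_sum, hm, mul_one, card_univ, nsmul_eq_mul] at h1
  rw [← h1, mul_sum]

variable (f : (x : N) → ((y : N) → β y) → ℝ)

open Classical in
/-- The sum of the product of the weights of the vertices in `A` over all assignments that agree
with `w` on `X`. -/
noncomputable def marg (A : Finset N) (X : Set N) (w : (x : N) → β x) : ℝ :=
  ∑ w' with ∀ v ∈ X, w' v = w v, ∏ v ∈ A, f v w'

variable {f} {R : N → N → Prop}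

theorem marg_congr {f' : (x : N) → ((y : N) → β y) → ℝ} {A : Finset N} {X : Set N}
    {w : (x : N) → β x}
    (h : ∀ w', (∀ v ∈ X, w' v = w v) → ∀ v ∈ A, f v w' = f' v w') :
    marg f A X w = marg f' A X w := by
  unfold marg
  refine sum_congr rfl fun w' hw' => prod_congr rfl (h w' ?_)
  simpa using hw'

/-- If no other weight depends on the coordinate `v`, then replacing the weight of `v` by a point
mass of size `r` at the value `w v` multiplies the marginals that do not involve `v` by `r`. -/
theorem mul_marg_eq_marg_insert {f' : (x : N) → ((y : N) → β y) → ℝ} {v : N} {X : Set N}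
    (hv : v ∉ X) {w : (x : N) → β x} {r : ℝ}
    (hcut : ∀ x ≠ v, ∀ w' b, f x (update w' v b) = f x w')
    (hsum : ∀ w', ∑ b, f v (update w' v b) = 1)
    (hfv : ∀ w', w' v = w v → f' v w' = r)
    (hfx : ∀ x ≠ v, ∀ w', w' v = w v → f' x w' = f x w') :
    r * marg f univ X w = marg f' univ (insert v X) w := by
  classical
  let P : ((x : N) → β x) → Prop := fun w' => ∀ u ∈ X, w' u = w u
  let g : ((x : N) → β x) → ℝ := fun w' => ∏ x ∈ univ.erase v, f x w'
  have hP : ∀ w' b, P (update w' v b) ↔ P w' := fun w' b => forall₂_congr fun u hu => by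
    rw [update_of_ne (ne_of_mem_of_not_mem hu hv)]
  have hg : ∀ w' b, g (update w' v b) = g w' := fun w' b =>
    prod_congr rfl fun x hx => hcut x (mem_erase.1 hx).1 w' b
  have h1 := card_mul_sum_mul_eq_sum v P hP g (f v) hg hsum
  have h2 := card_mul_sum_mul_eq_sum v P hP g (fun w' => if w' v = w v then (1 : ℝ) else 0) hg
    (by simp)
  have hc : (Fintype.card (β v) : ℝ) ≠ 0 := by
    exact_mod_cast (Fintype.card_pos_iff.2 ⟨w v⟩).ne'
  have h3 := mul_left_cancel₀ hc (h1.trans h2.symm)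
  have h4 : marg f univ X w = ∑ w' with P w', g w' * f v w' := by
    unfold marg
    refine sum_congr (filter_congr_decidable _ _ _) fun w' _ => ?_
    exact (prod_erase_mul _ _ (mem_univ _)).symm
  rw [h4, h3]
  simp only [mul_ite, mul_one, mul_zero]
  rw [← sum_filter, filter_filter, mul_sum]
  unfold marg
  refine sum_congr ?_ fun w' hw' => ?_
  · ext w'
    simp only [P, mem_filter, mem_univ, true_and, Set.forall_mem_insert]
    exact and_comm
  · simp only [mem_filter, mem_univ, true_and, Set.forall_mem_insert] at hw'
    have hi := hw'.1
    rw [← mul_prod_erase univ _ (mem_univ v), hfv w' hi]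
    congr 1
    exact prod_congr rfl fun x hx => (hfx x (mem_erase.1 hx).1 w' hi).symm


/-- Up to a constant factor, the marginal law on an ancestral set is the product of the weights of
its vertices. -/
theorem exists_marg_univ_mul_eq [∀ v, Nonempty (β v)] (hR : ∀ v, ¬ Relation.TransGen R v v)
    (hf : ∀ v w w', w v = w' v → (∀ u, R u v → w u = w' u) → f v w = f v w')
    (hsum : ∀ v w, ∑ a, f v (update w v a) = 1) (A : Finset N)
    (hA : ∀ v ∈ A, ∀ u, R u v → u ∈ A) :
    ∃ K : ℝ, K ≠ 0 ∧ ∀ X : Set N, X ⊆ A → ∀ w, K * marg f univ X w = marg f A X w := by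
  classical
  induction h : #Aᶜ generalizing A with
  | zero =>
    rw [card_eq_zero, compl_eq_empty_iff] at h
    subst h
    exact ⟨1, one_ne_zero, fun X _ w => one_mul _⟩
  | succ k ih =>
    have hne : (Aᶜ : Finset N).Nonempty := card_pos.1 (by omega)
    have hwf : WellFounded (Relation.TransGen R) := by
      have : Std.Irrefl (Relation.TransGen R) := ⟨hR⟩
      exact Finite.wellFounded_of_trans_of_irrefl _
    obtain ⟨v, hv, hmin⟩ := hwf.has_min (Aᶜ : Finset N) hne
    have hvA : v ∉ A := by simpa using hv
    have hpar : ∀ u, R u v → u ∈ A := fun u hu => by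
      by_contra hu'
      exact hmin u (by simpa using hu') (.single hu)
    obtain ⟨K, hK, hKX⟩ := ih (insert v A)
      (fun a ha u hu => by
        rcases mem_insert.1 ha with rfl | ha
        · exact mem_insert_of_mem (hpar u hu)
        · exact mem_insert_of_mem (hA a ha u hu))
      (by rw [compl_insert, card_erase_of_mem (by simpa using hv)]; omega)
    refine ⟨Fintype.card (β v) * K, mul_ne_zero (by simp) hK, fun X hX w => ?_⟩
    rw [mul_assoc, hKX X (hX.trans (by simp)) w]
    unfold marg
    simp only [prod_insert hvA, mul_comm (f v _)]
    refine card_mul_sum_mul_eq_sum v _ ?_ _ _ ?_ (hsum v)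
    · intro w' a
      refine forall₂_congr fun u hu => ?_
      rw [update_of_ne]
      rintro rfl
      exact hvA (hX hu)
    · intro w' a
      refine prod_congr rfl fun u hu => hf u _ _ ?_ fun t ht => ?_
      · exact update_of_ne (ne_of_mem_of_not_mem hu hvA) _ _
      · exact update_of_ne (ne_of_mem_of_not_mem (hA u hu t ht) hvA) _ _

/-- If every weight depends only on coordinates in `U ∪ Z` or only on coordinates outside `U`, then
`x ∉ U` and `y ∈ U` are independent given `Z`: exchanging the coordinates in `U` between two
assignments that agree on `Z` does not change the product of their weights. -/
theorem marg_mul_marg_of_split {A : Finset N} {U Z : Set N} {x y : N} (hx : x ∉ U) (hy : y ∈ U)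
    (hZ : ∀ z ∈ Z, z ∉ U)
    (hsplit : ∀ v ∈ A,
      (∀ w w', (∀ u, u ∈ U ∨ u ∈ Z → w u = w' u) → f v w = f v w') ∨
      (∀ w w', (∀ u, u ∉ U → w u = w' u) → f v w = f v w')) (w : (x : N) → β x) :
    marg f A (insert x (insert y Z)) w * marg f A Z w =
      marg f A (insert x Z) w * marg f A (insert y Z) w := by
  classical
  let sw : ((x : N) → β x) → ((x : N) → β x) → ((x : N) → β x) :=
    fun w₁ w₂ u => if u ∈ U then w₂ u else w₁ u
  have sw_mem : ∀ w₁ w₂ u, u ∈ U → sw w₁ w₂ u = w₂ u := fun _ _ _ h => if_pos h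
  have sw_not : ∀ w₁ w₂ u, u ∉ U → sw w₁ w₂ u = w₁ u := fun _ _ _ h => if_neg h
  have sw_sw : ∀ w₁ w₂, sw (sw w₁ w₂) (sw w₂ w₁) = w₁ := fun w₁ w₂ => by
    ext1 u
    by_cases h : u ∈ U
    · rw [sw_mem _ _ _ h, sw_mem _ _ _ h]
    · rw [sw_not _ _ _ h, sw_not _ _ _ h]
  unfold marg
  rw [sum_mul_sum, sum_mul_sum, ← sum_product', ← sum_product']
  refine sum_nbij' (fun q => (sw q.1 q.2, sw q.2 q.1)) (fun q => (sw q.1 q.2, sw q.2 q.1))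
    ?_ ?_ ?_ ?_ ?_
  · rintro ⟨w₁, w₂⟩ h
    simp only [mem_product, mem_filter, mem_univ, true_and, Set.forall_mem_insert] at h ⊢
    obtain ⟨⟨h1, h2, h3⟩, h4⟩ := h
    refine ⟨⟨by rw [sw_not _ _ _ hx, h1], fun z hz => ?_⟩, by rw [sw_mem _ _ _ hy, h2],
      fun z hz => ?_⟩
    · rw [sw_not _ _ _ (hZ z hz), h3 z hz]
    · rw [sw_not _ _ _ (hZ z hz), h4 z hz]
  · rintro ⟨w₁, w₂⟩ h
    simp only [mem_product, mem_filter, mem_univ, true_and, Set.forall_mem_insert] at h ⊢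
    obtain ⟨⟨h1, h3⟩, h2, h4⟩ := h
    refine ⟨⟨by rw [sw_not _ _ _ hx, h1], by rw [sw_mem _ _ _ hy, h2], fun z hz => ?_⟩,
      fun z hz => ?_⟩
    · rw [sw_not _ _ _ (hZ z hz), h3 z hz]
    · rw [sw_not _ _ _ (hZ z hz), h4 z hz]
  · rintro ⟨w₁, w₂⟩ -
    simp only [sw_sw]
  · rintro ⟨w₁, w₂⟩ -
    simp only [sw_sw]
  · rintro ⟨w₁, w₂⟩ h
    simp only [mem_product, mem_filter, mem_univ, true_and, Set.forall_mem_insert] at h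
    obtain ⟨⟨h1, h2, h3⟩, h4⟩ := h
    dsimp only
    rw [← prod_mul_distrib, ← prod_mul_distrib]
    refine prod_congr rfl fun v hv => ?_
    rcases hsplit v hv with hs | hs
    · rw [hs (sw w₁ w₂) w₂, hs (sw w₂ w₁) w₁, mul_comm]
      all_goals
        rintro u (hu | hu)
        · exact sw_mem _ _ _ hu
        · rw [sw_not _ _ _ (hZ u hu), h3 u hu, h4 u hu]
    · rw [hs (sw w₁ w₂) w₁ fun u => sw_not _ _ u, hs (sw w₂ w₁) w₂ fun u => sw_not _ _ u]

/-- The global Markov property: d-separation implies conditional independence for a law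
that factorizes along an acyclic graph. -/
theorem marg_mul_marg_of_dSep [∀ v, Nonempty (β v)] (hR : ∀ v, ¬ Relation.TransGen R v v)
    (hf : ∀ v w w', w v = w' v → (∀ u, R u v → w u = w' u) → f v w = f v w')
    (hsum : ∀ v w, ∑ a, f v (update w v a) = 1) {x y : N} {Z : Set N} (hy : y ∉ Z)
    (hs : DSep R x y Z) (w : (x : N) → β x) :
    marg f univ (insert x (insert y Z)) w * marg f univ Z w =
      marg f univ (insert x Z) w * marg f univ (insert y Z) w := by
  classical
  set A : Finset N := univ.filter (· ∈ ancSet R x y Z) with hA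
  have hmem : ∀ {v}, v ∈ A ↔ v ∈ ancSet R x y Z := by simp [hA]
  have hanc : ∀ v ∈ A, ∀ u, R u v → u ∈ A := by
    intro v hv u hu
    obtain ⟨d, hd, hvd⟩ := hmem.1 hv
    exact hmem.2 ⟨d, hd, .head hu hvd⟩
  obtain ⟨K, hK, hKX⟩ := exists_marg_univ_mul_eq hR hf hsum A hanc
  have hxA : x ∈ A := hmem.2 ⟨x, by simp, .refl⟩
  have hyA : y ∈ A := hmem.2 ⟨y, by simp, .refl⟩
  have hZA : Z ⊆ A := fun z hz => hmem.2 ⟨z, by simp [hz], .refl⟩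
  set U : Set N := {u | Relation.ReflTransGen (MoralAdj R x y Z) y u} with hU
  have hZU : ∀ z ∈ Z, z ∉ U := by
    intro z hz hzU
    rcases Relation.ReflTransGen.cases_tail hzU with rfl | ⟨c, -, hc⟩
    · exact hy hz
    · exact hc.2.1.2 hz
  have hstep : ∀ a b, a ∈ U → b ∉ Z → a ∈ A → b ∈ A →
      (R a b ∨ R b a ∨ ∃ c ∈ ancSet R x y Z, R a c ∧ R b c) → b ∈ U := by
    intro a b ha hb haA hbA h
    exact Relation.ReflTransGen.tail ha
      ⟨⟨hmem.1 haA, fun hz => hZU a hz ha⟩, ⟨hmem.1 hbA, hb⟩, h⟩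
  -- A vertex together with its parents is a clique of the moral graph.
  have hsplit : ∀ v ∈ A,
      (∀ w w', (∀ u, u ∈ U ∨ u ∈ Z → w u = w' u) → f v w = f v w') ∨
      (∀ w w', (∀ u, u ∉ U → w u = w' u) → f v w = f v w') := by
    intro v hv
    by_cases h : ∃ a ∈ U, a = v ∨ R a v
    · left
      obtain ⟨a, ha, hav⟩ := h
      have haA : a ∈ A := by
        rcases hav with rfl | hav
        · exact hv
        · exact hanc v hv a hav
      intro w w' hw
      refine hf v w w' (hw v ?_) fun u hu => hw u ?_
      · by_cases hvZ : v ∈ Z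
        · exact Or.inr hvZ
        · rcases hav with rfl | hav
          · exact Or.inl ha
          · exact Or.inl (hstep a v ha hvZ haA hv (Or.inl hav))
      · by_cases huZ : u ∈ Z
        · exact Or.inr huZ
        · rcases hav with rfl | hav
          · exact Or.inl (hstep a u ha huZ haA (hanc a hv u hu) (Or.inr (Or.inl hu)))
          · exact Or.inl (hstep a u ha huZ haA (hanc v hv u hu)
              (Or.inr (Or.inr ⟨v, hmem.1 hv, hav, hu⟩)))
    · right
      push Not at h
      intro w w' hw
      exact hf v w w' (hw v fun hvU => (h v hvU).1 rfl) fun u hu => hw u fun huU => (h u huU).2 hu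
  have key := marg_mul_marg_of_split (f := f) (A := A) (U := U) (Z := Z) (x := x) (y := y)
    (not_moral_reach_of_dSep hR hs) Relation.ReflTransGen.refl hZU hsplit w
  rw [← hKX _ (Set.insert_subset hxA (Set.insert_subset hyA hZA)), ← hKX _ hZA,
    ← hKX _ (Set.insert_subset hxA hZA), ← hKX _ (Set.insert_subset hyA hZA)] at key
  have hK2 : K * K ≠ 0 := mul_ne_zero hK hK
  refine mul_left_cancel₀ hK2 ?_
  linear_combination key

end Markov

/-! ### Interventional distributions: d-separation and the do-see rule -/

section Graph

variable {n : ℕ} {G : LatentGraph n}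

namespace LatentGraph

theorem not_arrow_inr (x : G.Node) (e : {e : Sym2 (Fin n) // e ∈ G.latents}) :
    ¬ G.Arrow x (Sum.inr e) := by
  rcases x with a | e' <;> exact fun h => h

theorem exists_transGen_edges {a : Fin n} {y : G.Node}
    (h : Relation.TransGen G.Arrow (Sum.inl a) y) :
    ∃ b, y = Sum.inl b ∧ Relation.TransGen (fun a b => (a, b) ∈ G.edges) a b := by
  induction h with
  | @single y h =>
    rcases y with b | e
    · exact ⟨b, rfl, .single h⟩
    · exact absurd h (not_arrow_inr _ _)
  | @tail y z _ hyz ih =>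
    obtain ⟨b, rfl, hb⟩ := ih
    rcases z with c | e
    · exact ⟨c, rfl, hb.tail hyz⟩
    · exact absurd hyz (not_arrow_inr _ _)

theorem IsCausal.arrow_acyclic (hG : G.IsCausal) (v : G.Node) :
    ¬ Relation.TransGen G.Arrow v v := by
  intro h
  rcases v with a | e
  · obtain ⟨b, hb, h'⟩ := exists_transGen_edges h
    obtain rfl := Sum.inl_injective hb
    exact hG.1 _ h'
  · obtain ⟨y, -, hy⟩ := Relation.TransGen.tail'_iff.1 h
    exact not_arrow_inr _ _ hy

theorem IsCausal.arrowDo_acyclic (hG : G.IsCausal) (S : Finset (Fin n)) (v : G.Node) :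
    ¬ Relation.TransGen (G.ArrowDo S) v v :=
  fun h => hG.arrow_acyclic v (Relation.TransGen.mono (fun _ _ h => h.1) _ _ h)

theorem IsCausal.arrowDoCut_acyclic (hG : G.IsCausal) (S : Finset (Fin n)) (i : Fin n)
    (v : G.Node) : ¬ Relation.TransGen (G.ArrowDoCut S i) v v :=
  fun h => hG.arrow_acyclic v (Relation.TransGen.mono (fun _ _ h => h.1.1) _ _ h)

@[simp] theorem inl_mem_obs {S : Finset (Fin n)} {v : Fin n} :
    (Sum.inl v : G.Node) ∈ G.obs S ↔ v ∈ S := by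
  simp [obs]

@[simp] theorem inr_notMem_obs {S : Finset (Fin n)} {e : {e : Sym2 (Fin n) // e ∈ G.latents}} :
    (Sum.inr e : G.Node) ∉ G.obs S := by
  simp [obs]

theorem obs_insert (i : Fin n) (S : Finset (Fin n)) :
    G.obs (insert i S) = insert (Sum.inl i) (G.obs S) := by
  simp [obs, Set.image_insert_eq]

end LatentGraph

namespace CausalModel

open Function LatentGraph

variable (M : CausalModel G)

theorem nonempty_values (x : G.Node) : Nonempty (Fin (M.card x)) := ⟨⟨0, M.card_pos x⟩⟩

/-- The factor of the variable `x` in the law of `do(S)`. -/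
noncomputable def doWeight (S : Finset (Fin n)) : G.Node → M.Assignment → ℝ
  | Sum.inl v, w => if v ∈ S then M.rnd v (w (Sum.inl v)) else M.mech (Sum.inl v) w (w (Sum.inl v))
  | Sum.inr e, w => M.mech (Sum.inr e) w (w (Sum.inr e))

theorem law_eq_prod (S : Finset (Fin n)) (w : M.Assignment) :
    M.law S w = ∏ x, M.doWeight S x w := by
  rw [Fintype.prod_sum_type, law, doLaw, ← mul_assoc, ← prod_mul_prod_compl S
    fun v => M.doWeight S (Sum.inl v) w]
  congr 2
  · exact prod_congr rfl fun v hv => by simp [doWeight, hv]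
  · exact prod_congr rfl fun v hv => by simp [doWeight, mem_compl.1 hv]

theorem prob_eq_marg (S X : Finset (Fin n)) (w : M.Assignment) :
    M.prob S X w = marg (M.doWeight S) univ (G.obs X) w := by
  simp only [prob, marg, law_eq_prod]
  refine sum_congr ?_ fun _ _ => rfl
  ext w'
  simp [obs]

theorem doWeight_congr {S : Finset (Fin n)} {x : G.Node} {w w' : M.Assignment} (hx : w x = w' x)
    (h : ∀ y, G.ArrowDo S y x → w y = w' y) : M.doWeight S x w = M.doWeight S x w' := by
  rcases x with v | e
  · by_cases hv : v ∈ S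
    · simp [doWeight, hv, hx]
    · simp only [doWeight, hv, if_false, hx]
      rw [M.mech_local _ w w' fun y hy => h y ⟨hy, by simpa using hv⟩]
  · simp only [doWeight, hx]
    rw [M.mech_local _ w w' fun y hy => absurd hy (not_arrow_inr _ _)]

theorem sum_doWeight_update (hG : G.IsCausal) (S : Finset (Fin n)) (x : G.Node)
    (w : M.Assignment) : ∑ a, M.doWeight S x (update w x a) = 1 := by
  have hloc : ∀ a, M.mech x (update w x a) = M.mech x w := fun a =>
    M.mech_local _ _ _ fun y hy => update_of_ne (by
      rintro rfl
      exact hG.arrow_acyclic _ (.single hy)) _ _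
  rcases x with v | e
  · by_cases hv : v ∈ S
    · simpa [doWeight, hv] using M.rnd_sum v
    · simpa [doWeight, hv, hloc] using M.mech_sum _ w
  · simpa [doWeight, hloc] using M.mech_sum _ w

/-- The causal Markov property for every interventional distribution. -/
theorem condIndep_of_dSep (hG : G.IsCausal) {i j : Fin n} {Z S : Finset (Fin n)} (hj : j ∉ Z)
    (h : DSep (G.ArrowDo S) (Sum.inl i) (Sum.inl j) (G.obs Z)) : M.CondIndep i j Z S := by
  intro w
  have := M.nonempty_values
  simp only [prob_eq_marg, obs_insert]
  exact marg_mul_marg_of_dSep (hG.arrowDo_acyclic S) (fun v w w' => M.doWeight_congr)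
    (M.sum_doWeight_update hG S) (by simpa using hj) h w

/-- The factors of the model in which, under `do(S)`, all children of `i` receive the value `a` in
place of the value of `i`. -/
noncomputable def cutWeight (S : Finset (Fin n)) (i : Fin n) (a : Fin (M.card (Sum.inl i)))
    (x : G.Node) (w : M.Assignment) : ℝ :=
  if x = Sum.inl i then M.doWeight S x w else M.doWeight S x (update w (Sum.inl i) a)

theorem cutWeight_congr (hG : G.IsCausal) {S : Finset (Fin n)} {i : Fin n}
    {a : Fin (M.card (Sum.inl i))} {x : G.Node} {w w' : M.Assignment} (hx : w x = w' x)
    (h : ∀ y, G.ArrowDoCut S i y x → w y = w' y) :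
    M.cutWeight S i a x w = M.cutWeight S i a x w' := by
  unfold cutWeight
  split_ifs with hxi
  · refine M.doWeight_congr hx fun y hy => h y ⟨hy, ?_⟩
    rintro rfl
    exact hG.arrow_acyclic x (.single (hxi ▸ hy.1))
  · refine M.doWeight_congr (by rw [update_of_ne hxi, update_of_ne hxi, hx]) fun y hy => ?_
    by_cases hyi : y = Sum.inl i
    · subst hyi; simp
    · rw [update_of_ne hyi, update_of_ne hyi, h y ⟨hy, hyi⟩]

theorem sum_cutWeight_update (hG : G.IsCausal) (S : Finset (Fin n)) (i : Fin n)
    (a : Fin (M.card (Sum.inl i))) (x : G.Node) (w : M.Assignment) :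
    ∑ b, M.cutWeight S i a x (update w x b) = 1 := by
  unfold cutWeight
  split_ifs with hxi
  · exact M.sum_doWeight_update hG S x w
  · simp only [update_comm hxi]
    exact M.sum_doWeight_update hG S x _

/-- Where `i` takes the value that its children receive, nothing has changed. -/
theorem marg_cutWeight_insert (S : Finset (Fin n)) (i : Fin n) (X : Set G.Node)
    (w : M.Assignment) :
    marg (M.cutWeight S i (w (Sum.inl i))) univ (insert (Sum.inl i) X) w =
      marg (M.doWeight S) univ (insert (Sum.inl i) X) w := by
  refine marg_congr fun w' hw' x _ => ?_
  have hi : w' (Sum.inl i) = w (Sum.inl i) := hw' _ (Set.mem_insert _ _)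
  rw [cutWeight, ← hi, update_eq_self, ite_self]

/-- Ignoring the value of `i`, its children receiving `a` amounts to `i` being set to `a`. -/
theorem rnd_mul_marg_cutWeight (hG : G.IsCausal) (S : Finset (Fin n)) (i : Fin n) (X : Set G.Node)
    (hi : Sum.inl i ∉ X) (w : M.Assignment) :
    M.rnd i (w (Sum.inl i)) * marg (M.cutWeight S i (w (Sum.inl i))) univ X w =
      marg (M.doWeight (insert i S)) univ (insert (Sum.inl i) X) w := by
  refine mul_marg_eq_marg_insert hi (fun x hx w' b => ?_) (M.sum_cutWeight_update hG S i _ _)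
    (fun w' hw' => ?_) fun x hx w' hw' => ?_
  · simp [cutWeight, hx]
  · simp [doWeight, hw']
  · rw [cutWeight, if_neg hx, ← hw', update_eq_self]
    rcases x with v | e
    · have : v ≠ i := fun h => hx (h ▸ rfl)
      simp [doWeight, this]
    · rfl

/-- The rule of the do-calculus that exchanges an observation and an intervention. In the model in
which the children of `i` receive the constant `a`, which factorizes along the graph without the
arrows out of `i`, the event that `i` takes the value `a` has the same joint probabilities as under
`do(S)`, and all other marginals are those of setting `i` to `a`. -/
theorem doSeeEq_of_dSep (hG : G.IsCausal) {i j : Fin n} {Z S : Finset (Fin n)} (hij : i ≠ j)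
    (hi : i ∉ Z) (hj : j ∉ Z)
    (h : DSep (G.ArrowDoCut S i) (Sum.inl i) (Sum.inl j) (G.obs Z)) : M.DoSeeEq i j Z S := by
  intro w
  have := M.nonempty_values
  have key := marg_mul_marg_of_dSep (f := M.cutWeight S i (w (Sum.inl i)))
    (hG.arrowDoCut_acyclic S i) (fun v w w' => M.cutWeight_congr hG)
    (M.sum_cutWeight_update hG S i _) (by simpa using hj) h w
  simp only [prob_eq_marg, Finset.insert_comm j i, obs_insert]
  rw [← M.rnd_mul_marg_cutWeight hG S i (G.obs Z) (by simpa using hi),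
    ← M.rnd_mul_marg_cutWeight hG S i (insert (Sum.inl j) (G.obs Z))
      (by simpa [hij] using hi), ← marg_cutWeight_insert, ← marg_cutWeight_insert]
  linear_combination M.rnd i (w (Sum.inl i)) * key

theorem doSeeEq_erase {i j : Fin n} {Z S : Finset (Fin n)} :
    M.DoSeeEq i j (Z.erase i) S ↔ M.DoSeeEq i j Z S := by
  have : insert i (Z.erase i) = insert i Z := by
    ext k
    by_cases h : k = i <;> simp [h]
  simp only [DoSeeEq, this]

end CausalModel

end Graph

/-! ### The d-separations behind the tests -/

section Separations

variable {n : ℕ} {G : LatentGraph n}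

namespace LatentGraph

theorem Arrow.exists_eq_inl {x y : G.Node} (h : G.Arrow x y) : ∃ b, y = Sum.inl b := by
  rcases y with b | e
  · exact ⟨b, rfl⟩
  · exact absurd h (not_arrow_inr _ _)

theorem exists_reflTransGen_edges {a : Fin n} {y : G.Node}
    (h : Relation.ReflTransGen G.Arrow (Sum.inl a) y) :
    ∃ b, y = Sum.inl b ∧ Relation.ReflTransGen (fun a b => (a, b) ∈ G.edges) a b := by
  rcases Relation.reflTransGen_iff_eq_or_transGen.1 h with rfl | h
  · exact ⟨a, rfl, .refl⟩
  · obtain ⟨b, hb, h'⟩ := exists_transGen_edges h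
    exact ⟨b, hb, h'.to_reflTransGen⟩

/-- `i` is a proper ancestor of `j` in the observable graph. -/
def IsAnc (G : LatentGraph n) (i j : Fin n) : Prop :=
  Relation.TransGen (fun a b => (a, b) ∈ G.edges) i j

/-- A walk without repeated vertices between the observables `i` and `j` that is active for a
relation `R`, which in the applications is the graph of an intervention. -/
structure IsActivePath (R : G.Node → G.Node → Prop) (Z : Set G.Node) (i j : Fin n) (m : ℕ)
    (w : ℕ → G.Node) : Prop where
  active : IsActiveWalk R Z m w
  inj : Set.InjOn w (Set.Iic m)
  start : w 0 = Sum.inl i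
  finish : w m = Sum.inl j
  le_arrow : ∀ x y, R x y → G.Arrow x y

namespace IsActivePath

variable {R : G.Node → G.Node → Prop} {Z : Set G.Node} {i j : Fin n} {m : ℕ} {w : ℕ → G.Node}

theorem ne (h : IsActivePath R Z i j m w) {k l : ℕ} (hk : k ≤ m) (hl : l ≤ m) (hkl : k ≠ l) :
    w k ≠ w l := fun he => hkl (h.inj hk hl he)

/-- A collider on an active path is an observable with a descendant in the conditioning set. -/
theorem exists_of_collider (h : IsActivePath R Z i j m w) {k : ℕ} (hk : k + 2 ≤ m)
    (h1 : R (w k) (w (k + 1))) (h2 : R (w (k + 2)) (w (k + 1))) :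
    ∃ c d, w (k + 1) = Sum.inl c ∧ Sum.inl d ∈ Z ∧
      Relation.ReflTransGen (fun a b => (a, b) ∈ G.edges) c d := by
  obtain ⟨c, hc⟩ := (h.le_arrow _ _ h1).exists_eq_inl
  have hb := h.active.not_blocks k hk
  simp only [Blocks, not_or, not_and, not_forall, not_not] at hb
  obtain ⟨d, hd, hdZ⟩ := hb.2 ⟨h1, h2⟩
  rw [hc] at hd
  obtain ⟨d, rfl, hcd⟩ := exists_reflTransGen_edges
    (Relation.ReflTransGen.mono h.le_arrow _ _ hd)
  exact ⟨c, d, hc, hdZ, hcd⟩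

theorem isPCollider (h : IsActivePath R Z i j m w) {k : ℕ} (hk : k + 2 ≤ m)
    (h1 : R (w k) (w (k + 1))) (h2 : R (w (k + 2)) (w (k + 1))) {c d : Fin n}
    (hc : w (k + 1) = Sum.inl c) (hcd : Relation.ReflTransGen (fun a b => (a, b) ∈ G.edges) c d)
    (hd : (d, i) ∈ G.edges ∨ (d, j) ∈ G.edges) : G.IsPCollider i j c := by
  refine ⟨?_, d, hcd, hd⟩
  have hp := exists_isPath (R := G.Arrow) m w
    (fun k hk => (h.active.adj k hk).imp (h.le_arrow _ _) (h.le_arrow _ _)) h.inj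
  rw [h.start, h.finish] at hp
  obtain ⟨p, hp, hs⟩ := hp
  rw [← hc]
  exact ⟨p, hp, w k, w (k + 2), by
    rw [hs, infix_map_range_iff]
    exact ⟨k, hk, rfl, rfl, rfl⟩, h.le_arrow _ _ h1, h.le_arrow _ _ h2⟩

/-- If no vertex from the position `k + 1` on is a collider, then a path that leaves the position
`k` along an arrow is directed from there on. -/
theorem rel_of_no_collider (h : IsActivePath R Z i j m w)
    (hnc : ∀ k, k + 2 ≤ m → R (w k) (w (k + 1)) → ¬ R (w (k + 2)) (w (k + 1))) {k : ℕ}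
    (hk : R (w k) (w (k + 1))) (l : ℕ) (hl : k + l < m) : R (w (k + l)) (w (k + l + 1)) := by
  induction l with
  | zero => exact hk
  | succ l ih =>
    exact (h.active.adj (k + (l + 1)) (by omega)).resolve_right
      (hnc (k + l) (by omega) (ih (by omega)))

theorem notMem_of_not_collider (h : IsActivePath R Z i j m w) {k : ℕ} (hk : k + 2 ≤ m)
    (hnc : ¬ (R (w k) (w (k + 1)) ∧ R (w (k + 2)) (w (k + 1)))) : w (k + 1) ∉ Z :=
  fun hZ => h.active.not_blocks k hk (Or.inl ⟨hnc, hZ⟩)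

/-- The second to last vertex of an active path that ends with two arrows in the direction of `j` is
a parent of `j` outside the conditioning set. -/
theorem exists_parent_notMem (hG : G.IsCausal) (h : IsActivePath R Z i j m w) {k : ℕ}
    (hk : k + 2 = m) (h1 : R (w k) (w (k + 1))) (h2 : R (w (k + 1)) (w (k + 2))) :
    ∃ p, (p, j) ∈ G.edges ∧ p ≠ i ∧ Sum.inl p ∉ Z := by
  obtain ⟨p, hp⟩ := (h.le_arrow _ _ h1).exists_eq_inl
  have hfin := h.finish
  refine ⟨p, ?_, ?_, ?_⟩
  · have := h.le_arrow _ _ h2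
    rwa [hk, hp, hfin] at this
  · rintro rfl
    exact h.ne (k := k + 1) (l := 0) (by omega) (by omega) (by omega) (by rw [hp, h.start])
  · rw [← hp]
    exact h.notMem_of_not_collider hk.le fun hc =>
      not_rel_symm hG.arrow_acyclic (h.le_arrow _ _ h2) (h.le_arrow _ _ hc.2)

end IsActivePath

theorem dSep_of_forall_isActivePath {R : G.Node → G.Node → Prop} {Z : Set G.Node} {i j : Fin n}
    (hR : ∀ x y, R x y → G.Arrow x y) (h : ∀ m w, ¬ IsActivePath R Z i j m w) :
    DSep R (Sum.inl i) (Sum.inl j) Z :=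
  dSep_iff.2 fun m w h1 h2 h3 h4 => h m w ⟨h1, h2, h3, h4, hR⟩

theorem IsActivePath.length_pos {R : G.Node → G.Node → Prop} {Z : Set G.Node} {i j : Fin n}
    {m : ℕ} {w : ℕ → G.Node} (h : IsActivePath R Z i j m w) (hij : i ≠ j) : 0 < m := by
  rcases Nat.eq_zero_or_pos m with rfl | hm
  · exact absurd (Sum.inl_injective (h.start.symm.trans h.finish)) hij
  · exact hm

/-- A vertex intervened on is separated from its non-descendants. -/
theorem dSep_empty_of_not_isAnc {i j : Fin n} {S : Finset (Fin n)}
    (hi : i ∈ S) (hij : i ≠ j) (h : ¬ G.IsAnc i j) :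
    DSep (G.ArrowDo S) (Sum.inl i) (Sum.inl j) (G.obs ∅) := by
  refine dSep_of_forall_isActivePath (fun _ _ h => h.1) fun m w hw => h ?_
  have hm := hw.length_pos hij
  have hfirst : G.ArrowDo S (w 0) (w (0 + 1)) :=
    (hw.active.adj 0 hm).resolve_right fun h' => h'.2 (by rw [hw.start]; simpa using hi)
  have hdir := hw.rel_of_no_collider (fun k hk h1 h2 => by
    obtain ⟨c, d, -, hd, -⟩ := hw.exists_of_collider hk h1 h2
    simp at hd) hfirst
  have key : ∀ l, l < m → Relation.TransGen G.Arrow (w 0) (w (l + 1)) := by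
    intro l
    induction l with
    | zero => exact fun _ => .single hfirst.1
    | succ l ih =>
      intro hl
      have := hdir (l + 1) (by omega)
      rw [zero_add] at this
      exact (ih (by omega)).tail this.1
  have := key (m - 1) (by omega)
  rw [show m - 1 + 1 = m by omega, hw.start, hw.finish] at this
  obtain ⟨b, hb, hib⟩ := exists_transGen_edges this
  obtain rfl := Sum.inl_injective hb
  exact hib

/-- An ancestor `i` of `j` that is not a parent of `j` is separated from `j` by the other ancestors
of `j` under an intervention on `i` and all `p`-colliders. The last arrow of an active path would
have to come from a latent, whose other child is an ancestor of `j` and hence a `p`-collider. -/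
theorem dSep_ancestors (hG : G.IsCausal) {i j : Fin n} {S Z : Finset (Fin n)}
    (hij : G.IsAnc i j) (hE : (i, j) ∉ G.edges) (hi : i ∈ S)
    (hS : ∀ k, G.IsPCollider i j k → k ∈ S) (hZ : ∀ k, k ∈ Z ↔ G.IsAnc k j ∧ k ≠ i) :
    DSep (G.ArrowDo S) (Sum.inl i) (Sum.inl j) (G.obs Z) := by
  refine dSep_of_forall_isActivePath (fun _ _ h => h.1) fun m w hw => ?_
  have hne : i ≠ j := by
    rintro rfl
    exact hG.1 _ hij
  have hm := hw.length_pos hne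
  -- A vertex that the path leaves in the direction of `i` is an ancestor of `j`.
  have hback : ∀ l < m, G.ArrowDo S (w (l + 1)) (w l) → ∃ a, w l = Sum.inl a ∧ G.IsAnc a j := by
    intro l
    induction l with
    | zero => exact fun _ _ => ⟨i, hw.start, hij⟩
    | succ l ih =>
      intro hl hr
      rcases hw.active.adj l (by omega) with h1 | h1
      · obtain ⟨c, d, hc, hd, hcd⟩ := hw.exists_of_collider (by omega) h1 hr
        rw [inl_mem_obs, hZ] at hd
        exact ⟨c, hc, Relation.TransGen.trans_right hcd hd.1⟩
      · obtain ⟨a, ha, haj⟩ := ih (by omega) h1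
        obtain ⟨b, hb⟩ := hr.1.exists_eq_inl
        have h2 := h1.1
        rw [ha, hb] at h2
        exact ⟨b, hb, Relation.TransGen.head h2 haj⟩
  obtain ⟨l, rfl⟩ : ∃ l, m = l + 1 := ⟨m - 1, by omega⟩
  have hfin := hw.finish
  have hlast : G.ArrowDo S (w l) (w (l + 1)) := by
    refine (hw.active.adj l (by omega)).resolve_right fun h' => ?_
    obtain ⟨a, ha, haj⟩ := hback l (by omega) h'
    have h2 := h'.1
    rw [ha, hfin] at h2
    exact hG.1 _ (haj.tail h2)
  rcases hwl : w l with p | e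
  · have hpj : (p, j) ∈ G.edges := by
      have := hlast.1
      rwa [hwl, hfin] at this
    rcases l with _ | l
    · rw [hw.start] at hwl
      exact hE (Sum.inl_injective hwl ▸ hpj)
    · refine hw.notMem_of_not_collider (k := l) le_rfl ?_ ?_
      · exact fun hc => not_rel_symm hG.arrow_acyclic hlast.1 hc.2.1
      · rw [hwl, inl_mem_obs, hZ]
        refine ⟨.single hpj, ?_⟩
        rintro rfl
        exact hw.ne (k := l + 1) (l := 0) (by omega) (by omega) (by omega) (by rw [hwl, hw.start])
  · rcases l with _ | l
    · rw [hw.start] at hwl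
      cases hwl
    have hr : G.ArrowDo S (w (l + 1)) (w l) := by
      refine (hw.active.adj l (by omega)).resolve_left fun h' => ?_
      have := h'.1
      rw [hwl] at this
      exact not_arrow_inr _ _ this
    obtain ⟨a, ha, haj⟩ := hback l (by omega) hr
    have haS : a ∉ S := by
      have := hr.2
      rwa [ha, inl_mem_obs] at this
    rcases l with _ | l
    · rw [hw.start] at ha
      exact haS (Sum.inl_injective ha ▸ hi)
    by_cases hc : G.ArrowDo S (w l) (w (l + 1))
    · obtain ⟨d, had, hdj⟩ := Relation.TransGen.tail'_iff.1 haj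
      exact haS (hS a (hw.isPCollider (by omega) hc hr ha had (Or.inr hdj)))
    · refine hw.notMem_of_not_collider (k := l) (by omega) (fun h => hc h.1) ?_
      rw [ha, inl_mem_obs, hZ]
      refine ⟨haj, ?_⟩
      rintro rfl
      exact hw.ne (k := l + 1) (l := 0) (by omega) (by omega) (by omega) (by rw [ha, hw.start])

theorem mk_mem_latents {i j : Fin n} (hij : i ≠ j)
    (e : {e : Sym2 (Fin n) // e ∈ G.latents}) (hi : i ∈ e.1) (hj : j ∈ e.1) :
    s(i, j) ∈ G.latents := by
  rw [← (Sym2.mem_and_mem_iff hij).1 ⟨hi, hj⟩]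
  exact e.2

/-- Non-adjacent observables without a common latent are separated by their parents under an
intervention on all `p`-colliders, since an active path would contain no collider. -/
theorem dSep_parents (hG : G.IsCausal) {i j : Fin n} {S Z : Finset (Fin n)} (hne : i ≠ j)
    (hij : (i, j) ∉ G.edges) (hji : (j, i) ∉ G.edges) (hl : s(i, j) ∉ G.latents)
    (hS : ∀ k, G.IsPCollider i j k → k ∈ S)
    (hZ : ∀ k, k ∈ Z ↔ (k, i) ∈ G.edges ∨ (k, j) ∈ G.edges) :
    DSep (G.ArrowDo S) (Sum.inl i) (Sum.inl j) (G.obs Z) := by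
  refine dSep_of_forall_isActivePath (fun _ _ h => h.1) fun m w hw => ?_
  have hm := hw.length_pos hne
  have hnc : ∀ k, k + 2 ≤ m → G.ArrowDo S (w k) (w (k + 1)) →
      ¬ G.ArrowDo S (w (k + 2)) (w (k + 1)) := by
    intro k hk h1 h2
    obtain ⟨c, d, hc, hd, hcd⟩ := hw.exists_of_collider hk h1 h2
    rw [inl_mem_obs, hZ] at hd
    refine h1.2 ?_
    rw [hc, inl_mem_obs]
    exact hS c (hw.isPCollider hk h1 h2 hc hcd hd)
  have hend : ∀ k, k + 2 = m → G.ArrowDo S (w k) (w (k + 1)) →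
      ¬ G.ArrowDo S (w (k + 1)) (w (k + 2)) := by
    intro k hk h1 h2
    obtain ⟨p, hp, -, hpZ⟩ := hw.exists_parent_notMem hG hk h1 h2
    exact hpZ (inl_mem_obs.2 ((hZ p).2 (Or.inr hp)))
  -- A directed piece that reaches `j` consists of a single arrow.
  have hdir : ∀ k, G.ArrowDo S (w k) (w (k + 1)) → k + 1 < m → False := by
    intro k hk hkm
    obtain ⟨r, rfl⟩ : ∃ r, m = k + r + 2 := ⟨m - k - 2, by omega⟩
    exact hend (k + r) rfl (hw.rel_of_no_collider hnc hk r (by omega))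
      (hw.rel_of_no_collider hnc hk (r + 1) (by omega))
  have hstart := hw.start
  have hfin := hw.finish
  have hm1 : 1 < m := by
    by_contra h
    obtain rfl : m = 1 := by omega
    rcases hw.active.adj 0 hm with h' | h'
    all_goals
      have h2 := h'.1
      rw [hstart, zero_add, hfin] at h2
    · exact hij h2
    · exact hji h2
  have hfirst : G.ArrowDo S (w 1) (w 0) :=
    (hw.active.adj 0 hm).resolve_left fun h' => hdir 0 h' hm1
  rcases hw1 : w 1 with p | e
  · refine hw.notMem_of_not_collider (k := 0) hm1
      (fun hc => not_rel_symm hG.arrow_acyclic hfirst.1 hc.1.1) ?_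
    have := hfirst.1
    rw [hw1, hstart] at this
    rw [zero_add, hw1, inl_mem_obs]
    exact (hZ p).2 (Or.inl this)
  · have h12 : G.ArrowDo S (w 1) (w 2) := by
      refine (hw.active.adj 1 hm1).resolve_right fun h' => ?_
      have := h'.1
      rw [hw1] at this
      exact not_arrow_inr _ _ this
    by_cases hm2 : m = 2
    · subst hm2
      have h1 := hfirst.1
      have h2 := h12.1
      rw [hw1, hstart] at h1
      rw [hw1, hfin] at h2
      exact hl (mk_mem_latents hne e h1 h2)
    · exact hdir 1 h12 (by omega)

/-- For an edge `i → j` without a common latent, `i` and `j` are separated by the other parents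
of `j` after deleting the arrows out of `i` and intervening on the parents of `i` and
all `p`-colliders. -/
theorem dSep_cut (hG : G.IsCausal) {i j : Fin n} {S Z : Finset (Fin n)}
    (hij : (i, j) ∈ G.edges) (hl : s(i, j) ∉ G.latents)
    (hS : ∀ k, G.IsPCollider i j k → k ≠ i → k ∈ S) (hpar : ∀ k, (k, i) ∈ G.edges → k ∈ S)
    (hZ : ∀ k, k ∈ Z ↔ (k, j) ∈ G.edges ∧ k ≠ i) :
    DSep (G.ArrowDoCut S i) (Sum.inl i) (Sum.inl j) (G.obs Z) := by
  refine dSep_of_forall_isActivePath (fun _ _ h => h.1.1) fun m w hw => ?_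
  have hne : i ≠ j := by
    rintro rfl
    exact hG.1 _ (.single hij)
  have hm := hw.length_pos hne
  have hstart := hw.start
  have hfin := hw.finish
  have hnc : ∀ k, k + 2 ≤ m → G.ArrowDoCut S i (w k) (w (k + 1)) →
      ¬ G.ArrowDoCut S i (w (k + 2)) (w (k + 1)) := by
    intro k hk h1 h2
    obtain ⟨c, d, hc, hd, hcd⟩ := hw.exists_of_collider hk h1 h2
    rw [inl_mem_obs, hZ] at hd
    refine h1.1.2 ?_
    rw [hc, inl_mem_obs]
    refine hS c (hw.isPCollider hk h1 h2 hc hcd (Or.inr hd.1)) ?_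
    rintro rfl
    exact hw.ne (k := k + 1) (l := 0) (by omega) (by omega) (by omega) (by rw [hc, hstart])
  have hend : ∀ k, k + 2 = m → G.ArrowDoCut S i (w k) (w (k + 1)) →
      ¬ G.ArrowDoCut S i (w (k + 1)) (w (k + 2)) := by
    intro k hk h1 h2
    obtain ⟨p, hp, hpi, hpZ⟩ := hw.exists_parent_notMem hG hk h1 h2
    exact hpZ (inl_mem_obs.2 ((hZ p).2 ⟨hp, hpi⟩))
  have hfirst : G.ArrowDoCut S i (w 1) (w 0) :=
    (hw.active.adj 0 hm).resolve_left fun h' => h'.2 hstart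
  have hm1 : 1 < m := by
    by_contra h
    obtain rfl : m = 1 := by omega
    have h2 := hfirst.1.1
    rw [hstart, hfin] at h2
    exact hG.1 _ ((Relation.TransGen.single hij).tail h2)
  have h12 : G.ArrowDoCut S i (w 1) (w 2) := by
    refine (hw.active.adj 1 hm1).resolve_right fun h' => ?_
    rcases hw1 : w 1 with p | e
    · refine h'.1.2 ?_
      have h2 := hfirst.1.1
      rw [hw1, hstart] at h2
      rw [hw1, inl_mem_obs]
      exact hpar p h2
    · have := h'.1.1
      rw [hw1] at this
      exact not_arrow_inr _ _ this
  by_cases hm2 : m = 2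
  · subst hm2
    have h1 := hfirst.1.1
    have h2 := h12.1.1
    rcases hw1 : w 1 with p | e
    · refine hw.notMem_of_not_collider (k := 0) le_rfl
        (fun hc => not_rel_symm hG.arrow_acyclic h1 hc.1.1.1) ?_
      rw [hw1, hfin] at h2
      rw [zero_add, hw1, inl_mem_obs]
      refine (hZ p).2 ⟨h2, ?_⟩
      rintro rfl
      exact h12.2 hw1
    · rw [hw1, hstart] at h1
      rw [hw1, hfin] at h2
      exact hl (mk_mem_latents hne e h1 h2)
  · obtain ⟨r, rfl⟩ : ∃ r, m = 1 + r + 2 := ⟨m - 3, by omega⟩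
    exact hend (1 + r) rfl (hw.rel_of_no_collider hnc h12 r (by omega))
      (hw.rel_of_no_collider hnc h12 (r + 1) (by omega))

/-! ### Edges and latents are visible to the tests -/

theorem not_dSep_of_rel {R : G.Node → G.Node → Prop} (hR : ∀ x y, R x y → G.Arrow x y)
    (hG : G.IsCausal) {x y : G.Node} {Z : Set G.Node} (h : R x y) :
    ¬ DSep R x y Z := by
  have hac : ∀ v, ¬ Relation.TransGen R v v := fun v h' =>
    hG.arrow_acyclic v (Relation.TransGen.mono hR _ _ h')
  refine not_dSep_of_dConn hac ⟨1, prepend x fun _ => y, ?_, rfl, rfl⟩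
  exact IsActiveWalk.prepend
    ⟨fun _ h => absurd h (by omega), fun _ h => absurd h (by omega)⟩ (Or.inl h)
    fun h => absurd h (by omega)

theorem not_dSep_of_common_parent {R : G.Node → G.Node → Prop}
    (hR : ∀ x y, R x y → G.Arrow x y) (hG : G.IsCausal) {x y z : G.Node} {Z : Set G.Node}
    (hx : R z x) (hy : R z y) (hz : z ∉ Z) : ¬ DSep R x y Z := by
  have hac : ∀ v, ¬ Relation.TransGen R v v := fun v h' =>
    hG.arrow_acyclic v (Relation.TransGen.mono hR _ _ h')
  refine not_dSep_of_dConn hac (DConn.of_rel hac ?_ hz hx)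
  refine ⟨1, prepend z fun _ => y, ?_, rfl, rfl⟩
  exact IsActiveWalk.prepend
    ⟨fun _ h => absurd h (by omega), fun _ h => absurd h (by omega)⟩ (Or.inl hy)
    fun h => absurd h (by omega)

end LatentGraph

end Separations
/-! ### Correctness of the algorithms -/

section Correctness

open LatentGraph

variable {n : ℕ} {G : LatentGraph n}

theorem exists_mem_sepSystem {i j : Fin n} (hij : i ≠ j) : ∃ S ∈ sepSystem n, i ∈ S ∧ j ∉ S := by
  obtain ⟨k, hk⟩ : ∃ k, (i : ℕ).testBit k ≠ (j : ℕ).testBit k := by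
    by_contra h
    push Not at h
    exact hij (Fin.ext (Nat.eq_of_testBit_eq h))
  have hlt : k < Nat.clog 2 n := by
    by_contra h
    have hbit : ∀ v : Fin n, (v : ℕ).testBit k = false := fun v =>
      Nat.testBit_lt_two_pow (v.2.trans_le ((Nat.le_pow_clog one_lt_two n).trans
        (Nat.pow_le_pow_right two_pos (not_lt.1 h))))
    exact hk ((hbit i).trans (hbit j).symm)
  refine ⟨univ.filter fun v : Fin n => (v : ℕ).testBit k = (i : ℕ).testBit k, ?_, by simp,
    by simpa using hk.symm⟩
  exact mem_image.2 ⟨(k, (i : ℕ).testBit k), by simpa using hlt, rfl⟩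

variable {M : CausalModel G}

theorem recoverAnc_iff (hG : G.IsCausal) (hM : M.IsFaithful) {i j : Fin n} :
    recoverAnc M.oracles i j ↔ G.IsAnc i j := by
  constructor
  · intro h
    have hstep : ∀ a b, (∃ S ∈ sepSystem n, a ∈ S ∧ b ∉ S ∧ ¬ M.oracles.ci a b ∅ S) →
        G.IsAnc a b := by
      rintro a b ⟨S, -, ha, hb, hci⟩
      by_contra hanc
      exact hci (M.condIndep_of_dSep hG (notMem_empty b)
        (dSep_empty_of_not_isAnc ha (ne_of_mem_of_not_mem ha hb) hanc))
    induction h with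
    | single h => exact hstep _ _ h
    | tail _ h ih => exact Relation.TransGen.trans ih (hstep _ _ h)
  · refine Relation.TransGen.mono (fun a b hab => ?_) i j
    have hne : a ≠ b := by
      rintro rfl
      exact hG.1 _ (.single hab)
    obtain ⟨S, hS, ha, hb⟩ := exists_mem_sepSystem hne
    refine ⟨S, hS, ha, hb, fun hci => ?_⟩
    exact not_dSep_of_rel (R := G.ArrowDo S) (fun _ _ h => h.1) hG
      (⟨hab, by simpa using hb⟩ : G.ArrowDo S (Sum.inl a) (Sum.inl b))
      (hM a b ∅ S hne (notMem_empty _) (notMem_empty _) hci)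

theorem recoverG_eq (hG : G.IsCausal) (hM : M.IsFaithful) {A : Finset (Finset (Fin n))}
    (hA : ∀ i j, i ≠ j → ∃ S ∈ A, i ∈ S ∧ j ∉ S ∧ ∀ k, G.IsPCollider i j k → k ∈ S) :
    recoverG M.oracles (recoverAnc M.oracles) A = G.edges := by
  classical
  ext ⟨i, j⟩
  simp only [recoverG, mem_filter, mem_univ, true_and]
  constructor
  · rintro ⟨hanc, hS⟩
    rw [recoverAnc_iff hG hM] at hanc
    have hne : i ≠ j := by
      rintro rfl
      exact hG.1 _ hanc
    by_contra hE
    obtain ⟨S, hSA, hi, hj, hk⟩ := hA i j hne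
    refine hS S hSA hi hj (M.condIndep_of_dSep hG (fun hj' => ?_)
      (dSep_ancestors hG hanc hE hi hk fun k => ?_))
    · simp only [mem_erase, mem_filter, mem_univ, true_and, recoverAnc_iff hG hM] at hj'
      exact hG.1 _ hj'.2
    · simp [recoverAnc_iff hG hM, and_comm]
  · intro hE
    have hne : i ≠ j := by
      rintro rfl
      exact hG.1 _ (.single hE)
    refine ⟨(recoverAnc_iff hG hM).2 (.single hE), fun S _ _ hj hci => ?_⟩
    refine not_dSep_of_rel (R := G.ArrowDo S) (fun _ _ h => h.1) hG
      (⟨hE, by simpa using hj⟩ : G.ArrowDo S (Sum.inl i) (Sum.inl j))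
      (hM i j _ S hne (by simp) (fun hj' => ?_) hci)
    simp only [mem_erase, mem_filter, mem_univ, true_and, recoverAnc_iff hG hM] at hj'
    exact hG.1 _ hj'.2

theorem mem_parents {E : Finset (Fin n × Fin n)} {i j : Fin n} :
    i ∈ parents E j ↔ (i, j) ∈ E := by
  simp [parents]

/-- The test of `LatentsNEdges` is correct for a pair that has a good set in `D`. -/
theorem mem_latents_iff_of_not_adj (hG : G.IsCausal) (hM : M.IsFaithful) {i j : Fin n}
    (hne : i ≠ j) (hij : (i, j) ∉ G.edges) (hji : (j, i) ∉ G.edges)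
    {D : Finset (Finset (Fin n))}
    (hD : ∃ S ∈ D, i ∉ S ∧ j ∉ S ∧ ∀ k, G.IsPCollider i j k → k ∈ S) :
    s(i, j) ∈ G.latents ↔ ∀ S ∈ D, i ∉ S → j ∉ S →
      ¬ M.CondIndep i j (parents G.edges i ∪ parents G.edges j) S := by
  have hloop : ∀ v, (v, v) ∉ G.edges := fun v h => hG.1 v (.single h)
  have hiZ : i ∉ parents G.edges i ∪ parents G.edges j := by simp [mem_parents, hloop, hij]
  have hjZ : j ∉ parents G.edges i ∪ parents G.edges j := by simp [mem_parents, hloop, hji]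
  constructor
  · intro hl S _ hi hj hci
    refine not_dSep_of_common_parent (R := G.ArrowDo S) (fun _ _ h => h.1) hG
      (z := Sum.inr ⟨_, hl⟩) ⟨?_, by simpa using hi⟩ ⟨?_, by simpa using hj⟩ (by simp)
      (hM i j _ S hne hiZ hjZ hci)
    · exact Sym2.mem_mk_left i j
    · exact Sym2.mem_mk_right i j
  · intro h
    by_contra hl
    obtain ⟨S, hSD, hi, hj, hS⟩ := hD
    exact h S hSD hi hj (M.condIndep_of_dSep hG hjZ
      (dSep_parents hG hne hij hji hl hS fun k => by simp [mem_parents]))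

/-- The test of `LatentsWEdges` is correct for an edge that has a good set in `B`. -/
theorem mem_latents_iff_of_edge (hG : G.IsCausal) (hM : M.IsDoSeeFaithful) {i j : Fin n}
    (hij : (i, j) ∈ G.edges) {B : Finset (Finset (Fin n))}
    (hB : ∃ S ∈ B, i ∈ S ∧ j ∉ S ∧ ∀ k, G.IsPCollider i j k → k ∈ S) :
    s(i, j) ∈ G.latents ↔ ∀ S ∈ B, i ∈ S → j ∉ S →
      ¬ M.DoSeeEq i j (parents G.edges j) (parents G.edges i ∪ S.erase i) := by
  have hloop : ∀ v, (v, v) ∉ G.edges := fun v h => hG.1 v (.single h)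
  have hji : (j, i) ∉ G.edges := fun h => hG.1 _ ((Relation.TransGen.single hij).tail h)
  have hne : i ≠ j := fun h => hloop j (h ▸ hij)
  -- The conditioning set contains `i`, which makes no difference to the comparison.
  have hjZ : j ∉ (parents G.edges j).erase i := by simp [mem_parents, hloop]
  have hiS : ∀ S : Finset (Fin n), i ∉ parents G.edges i ∪ S.erase i := by
    simp [mem_parents, hloop]
  constructor
  · intro hl S _ _ hj hds
    have hjS : j ∉ parents G.edges i ∪ S.erase i := by simp [mem_parents, hji, hj]
    refine not_dSep_of_common_parent (R := G.ArrowDoCut (parents G.edges i ∪ S.erase i) i)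
      (fun _ _ h => h.1.1) hG (z := Sum.inr ⟨_, hl⟩) ⟨⟨?_, ?_⟩, by simp⟩ ⟨⟨?_, ?_⟩, by simp⟩
      (by simp)
      (hM i j _ _ hne (notMem_erase _ _) hjZ (hiS S) hjS (M.doSeeEq_erase.2 hds))
    · exact Sym2.mem_mk_left i j
    · simpa using hiS S
    · exact Sym2.mem_mk_right i j
    · simpa using hjS
  · intro h
    by_contra hl
    obtain ⟨S, hSB, hi, hj, hS⟩ := hB
    refine h S hSB hi hj (M.doSeeEq_erase.1 (M.doSeeEq_of_dSep hG hne (notMem_erase _ _) hjZ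
      (dSep_cut hG hij hl (fun k hk hki => ?_) (fun k hk => ?_) fun k => ?_)))
    · simp [hki, hS k hk]
    · simp [mem_parents, hk]
    · simp [mem_parents, and_comm]

/-- The output is correct if every pair of observables has a good set in each collection. -/
theorem recoverGraph_eq (hG : G.IsCausal) (hM : M.IsFaithful) (hM' : M.IsDoSeeFaithful)
    {A D B : Finset (Finset (Fin n))}
    (hA : ∀ i j, i ≠ j → ∃ S ∈ A, i ∈ S ∧ j ∉ S ∧ ∀ k, G.IsPCollider i j k → k ∈ S)
    (hD : ∀ i j, i ≠ j → ∃ S ∈ D, i ∉ S ∧ j ∉ S ∧ ∀ k, G.IsPCollider i j k → k ∈ S)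
    (hB : ∀ i j, i ≠ j → ∃ S ∈ B, i ∈ S ∧ j ∉ S ∧ ∀ k, G.IsPCollider i j k → k ∈ S) :
    recoverGraph M.oracles A D B = G := by
  have hE := recoverG_eq hG hM hA
  have hloop : ∀ i j, (i, j) ∈ G.edges → i ≠ j := by
    rintro i j h rfl
    exact hG.1 _ (.single h)
  apply LatentGraph.ext
  · exact hE
  simp only [recoverGraph, hE]
  ext e
  simp only [mem_union, latentsNEdges, latentsWEdges, mem_image, mem_filter, mem_univ, true_and,
    Prod.exists]
  constructor
  · rintro (⟨i, j, ⟨hlt, hij, hji, h⟩, rfl⟩ | ⟨i, j, ⟨hij, h⟩, rfl⟩)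
    · exact (mem_latents_iff_of_not_adj hG hM hlt.ne hij hji (hD i j hlt.ne)).2 h
    · exact (mem_latents_iff_of_edge hG hM' hij (hB i j (hloop i j hij))).2 h
  · intro he
    induction e using Sym2.ind with
    | _ i j =>
    have hne : i ≠ j := hG.2 _ he
    have he' : s(j, i) ∈ G.latents := by rwa [Sym2.eq_swap]
    by_cases hij : (i, j) ∈ G.edges
    · exact Or.inr ⟨i, j, ⟨hij, (mem_latents_iff_of_edge hG hM' hij (hB i j hne)).1 he⟩, rfl⟩
    by_cases hji : (j, i) ∈ G.edges
    · exact Or.inr ⟨j, i, ⟨hji, (mem_latents_iff_of_edge hG hM' hji (hB j i hne.symm)).1 he'⟩,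
        Sym2.eq_swap⟩
    left
    rcases lt_or_gt_of_ne hne with hlt | hlt
    · exact ⟨i, j, ⟨hlt, hij, hji,
        (mem_latents_iff_of_not_adj hG hM hne hij hji (hD i j hne)).1 he⟩, rfl⟩
    · exact ⟨j, i, ⟨hlt, hji, hij,
        (mem_latents_iff_of_not_adj hG hM hne.symm hji hij (hD j i hne.symm)).1 he'⟩,
        Sym2.eq_swap⟩

theorem notMem_of_isPCollider {i j k : Fin n} (h : G.IsPCollider i j k) : k ≠ i ∧ k ≠ j := by
  obtain ⟨⟨p, hp, a, c, hs, -, -⟩, -⟩ := h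
  rw [support_eq_map_getVert, infix_map_range_iff] at hs
  obtain ⟨l, hl, -, hk, -⟩ := hs
  constructor
  · rintro rfl
    have := hp.getVert_injOn (show l + 1 ≤ p.length by omega) (show 0 ≤ p.length by omega)
      (by rw [← hk, SimpleGraph.Walk.getVert_zero])
    omega
  · rintro rfl
    have := hp.getVert_injOn (show l + 1 ≤ p.length by omega) (show p.length ≤ p.length by omega)
      (by rw [← hk, SimpleGraph.Walk.getVert_length])
    omega

end Correctness

/-! ### The interventions -/

section Interventions

variable {n : ℕ}

/-- The output depends only on the answers to queries on the interventions used. -/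
theorem recoverGraph_congr {O O' : Oracles n} {A D B : Finset (Finset (Fin n))}
    (h : Oracles.AgreeOn (interventions O A D B) O O') :
    recoverGraph O' A D B = recoverGraph O A D B := by
  classical
  have hanc : recoverAnc O' = recoverAnc O := by
    unfold recoverAnc
    congr 1
    ext i j
    refine exists_congr fun S => and_congr_right fun hS => ?_
    rw [(h i j ∅ S (by simp [interventions, hS])).1]
  have hE : recoverG O' (recoverAnc O) A = recoverG O (recoverAnc O) A := by
    ext ⟨i, j⟩
    simp only [recoverG, mem_filter, mem_univ, true_and]
    refine and_congr_right fun _ => forall₂_congr fun S hS => ?_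
    rw [(h i j _ S (by simp [interventions, hS])).1]
  unfold recoverGraph
  rw [hanc, hE]
  dsimp only
  congr 2
  · unfold latentsNEdges
    congr 1
    ext ⟨i, j⟩
    simp only [mem_filter, mem_univ, true_and]
    refine and_congr_right fun _ => and_congr_right fun _ => and_congr_right fun _ =>
      forall₂_congr fun S hS => ?_
    rw [(h i j _ S (by simp [interventions, hS])).1]
  · unfold latentsWEdges
    congr 1
    ext ⟨i, j⟩
    simp only [mem_filter]
    refine and_congr_right fun _ => forall₂_congr fun S hS => ?_
    have h1 : parents (recoverG O (recoverAnc O) A) i ∪ S.erase i ∈ interventions O A D B := by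
      simp only [interventions, mem_union, mem_image]
      exact Or.inl (Or.inr ⟨(i, S), by simpa using hS, rfl⟩)
    have h2 : insert i (parents (recoverG O (recoverAnc O) A) i ∪ S.erase i) ∈
        interventions O A D B := by
      simp only [interventions, mem_union, mem_image]
      exact Or.inr ⟨(i, S), by simpa using hS, rfl⟩
    rw [(h i j _ _ h1).2 h2]

theorem card_sepSystem_le (n : ℕ) : #(sepSystem n) ≤ 2 * Nat.clog 2 n := by
  refine card_image_le.trans ?_
  simp [mul_comm]

theorem card_interventions_le (O : Oracles n) (A D B : Finset (Finset (Fin n))) :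
    #(interventions O A D B) ≤ 2 * Nat.clog 2 n + #A + #D + n * #B + n * #B := by
  unfold interventions
  refine (card_union_le _ _).trans (add_le_add ((card_union_le _ _).trans (add_le_add
    ((card_union_le _ _).trans (add_le_add ((card_union_le _ _).trans (add_le_add
      (card_sepSystem_le n) le_rfl)) le_rfl)) ?_)) ?_)
  all_goals
    refine card_image_le.trans ?_
    simp

/-- All rounding errors are absorbed by `1 ≤ 2 log n`, and one factor of the `τ' ^ 2` in the size of
the collection for `LatentsNEdges` by `τ' ≤ n`. -/
theorem card_le_mul_log {τ : ℕ} (hn : τ + 2 ≤ n) (O : Oracles n) (ω : Sample n τ) :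
    (#(interventions O (collA ω) (collD ω) (collB ω)) : ℝ) ≤
      1000 * (n * τ * Real.log n + n * Real.log n) := by
  have hA : #(collA ω) ≤ numEdgeSets n τ := card_image_le.trans (by simp)
  have hD : #(collD ω) ≤ numNonEdgeSets n τ := card_image_le.trans (by simp)
  have hB : #(collB ω) ≤ numEdgeSets n τ := card_image_le.trans (by simp)
  have hn2 : (2 : ℝ) ≤ n := by exact_mod_cast (show 2 ≤ n by omega)
  have hτ0 : (0 : ℝ) ≤ τ := Nat.cast_nonneg τ
  set L := Real.log n with hL
  have hL2 : Real.log 2 ≤ L := Real.log_le_log (by norm_num) hn2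
  have hl2 := Real.log_two_gt_d9
  have h1L : 1 ≤ 2 * L := by linarith
  have ht : (tauMax τ : ℝ) ≤ τ + 2 := by
    exact_mod_cast (show tauMax τ ≤ τ + 2 by unfold tauMax; omega)
  have htn : (tauMax τ : ℝ) ≤ n := by
    exact_mod_cast (show tauMax τ ≤ n by unfold tauMax; omega)
  have ht0 : (0 : ℝ) ≤ tauMax τ := Nat.cast_nonneg _
  have hm : (numEdgeSets n τ : ℝ) ≤ (72 * τ + 146) * L := by
    have h1 : (numEdgeSets n τ : ℝ) < 72 * (tauMax τ : ℝ) * L + 1 :=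
      Nat.ceil_lt_add_one (by positivity)
    nlinarith
  have hd : (numNonEdgeSets n τ : ℝ) ≤ (24 * (n * (τ + 2)) + 2) * L := by
    have h1 : (numNonEdgeSets n τ : ℝ) < 24 * (tauMax τ : ℝ) ^ 2 * L + 1 :=
      Nat.ceil_lt_add_one (by positivity)
    have h2 : (tauMax τ : ℝ) ^ 2 ≤ n * (τ + 2) := by nlinarith
    nlinarith
  have hc : (Nat.clog 2 n : ℝ) ≤ 4 * L := by
    have h1 := Nat.pow_pred_clog_lt_self one_lt_two (show 1 < n by omega)
    have h2 : (2 : ℝ) ^ (Nat.clog 2 n - 1) ≤ n := by exact_mod_cast h1.le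
    have h3 := Real.log_le_log (by positivity) h2
    rw [Real.log_pow] at h3
    have h4 : (Nat.clog 2 n : ℝ) ≤ ((Nat.clog 2 n - 1 : ℕ) : ℝ) + 1 := by
      exact_mod_cast (show Nat.clog 2 n ≤ Nat.clog 2 n - 1 + 1 by omega)
    have h5 : (0 : ℝ) ≤ ((Nat.clog 2 n - 1 : ℕ) : ℝ) := Nat.cast_nonneg _
    nlinarith
  have hcard : (#(interventions O (collA ω) (collD ω) (collB ω)) : ℝ) ≤
      2 * Nat.clog 2 n + numEdgeSets n τ + numNonEdgeSets n τ + n * numEdgeSets n τ +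
        n * numEdgeSets n τ := by
    refine le_trans (Nat.cast_le.2 (card_interventions_le O _ _ _)) ?_
    push_cast
    gcongr
  have hL0 : 0 ≤ L := by linarith
  have hnm : n * (numEdgeSets n τ : ℝ) ≤ n * ((72 * τ + 146) * L) := by gcongr
  have e1 : 0 ≤ (n - 2) * (τ * L) := mul_nonneg (by linarith) (by positivity)
  have e2 : 0 ≤ (n - 2) * L := mul_nonneg (by linarith) hL0
  have e3 : 0 ≤ τ * L := by positivity
  have e4 : 0 ≤ n * (τ * L) := by positivity
  nlinarith

end Interventions

/-! ### The random intervention sets -/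

section Random

variable {n τ : ℕ}

instance : IsProbabilityMeasure (sampleLaw n τ) := by
  unfold sampleLaw; infer_instance

theorem measureReal_pi_cylinder (p : unitInterval) {I Q : Finset (Fin n)} (h : Disjoint I Q) :
    (Measure.pi fun _ : Fin n => bernoulliMeasure true false p).real
      {η | (∀ v ∈ I, η v = true) ∧ ∀ v ∈ Q, η v = false} = (p : ℝ) ^ #I * (1 - (p : ℝ)) ^ #Q := by
  have hset : {η : Fin n → Bool | (∀ v ∈ I, η v = true) ∧ ∀ v ∈ Q, η v = false} =
      Set.pi Set.univ fun v => if v ∈ I then {true} else if v ∈ Q then {false} else Set.univ := by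
    ext η
    simp only [Set.mem_ofPred_eq, Set.mem_pi, Set.mem_univ, true_implies]
    constructor
    · rintro ⟨h1, h2⟩ v
      split_ifs with hI hQ
      · exact h1 v hI
      · exact h2 v hQ
      · trivial
    · intro hv
      refine ⟨fun v hI => by simpa [hI] using hv v, fun v hQ => ?_⟩
      have hI : v ∉ I := fun hI => disjoint_left.1 h hI hQ
      simpa [hI, hQ] using hv v
  have hfac : ∀ v : Fin n, (bernoulliMeasure true false p).real
      (if v ∈ I then {true} else if v ∈ Q then {false} else Set.univ) =
        (if v ∈ I then (p : ℝ) else 1) * (if v ∈ Q then 1 - (p : ℝ) else 1) := by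
    intro v
    by_cases hI : v ∈ I
    · have hQ : v ∉ Q := disjoint_left.1 h hI
      simp [hI, hQ]
    · by_cases hQ : v ∈ Q <;> simp [hI, hQ]
  rw [hset, measureReal_def, Measure.pi_pi, ENNReal.toReal_prod]
  simp only [← measureReal_def, hfac, prod_mul_distrib]
  simp [prod_ite_mem]

theorem inclusion_pow_mul_le_one (p : unitInterval) (a b : ℕ) :
    (p : ℝ) ^ a * (1 - (p : ℝ)) ^ b ≤ 1 :=
  mul_le_one₀ (pow_le_one₀ p.2.1 p.2.2) (pow_nonneg (by linarith [p.2.2]) _)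
    (pow_le_one₀ (by linarith [p.2.2]) (by linarith [p.2.1]))

/-- The rows of the sample are independent: the probability that none of the sets with index in `T`
contains `I` and avoids `Q`. -/
theorem measureReal_forall_not (T : Finset (SetIndex n τ)) {I Q : Finset (Fin n)}
    (h : Disjoint I Q) :
    (sampleLaw n τ).real {ω | ∀ t ∈ T, ¬ ((∀ v ∈ I, v ∈ randomSet ω t) ∧
      ∀ v ∈ Q, v ∉ randomSet ω t)} =
      (1 - (inclusionProb τ : ℝ) ^ #I * (1 - (inclusionProb τ : ℝ)) ^ #Q) ^ #T := by
  classical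
  set p := inclusionProb τ with hp
  set ν : Measure (Fin n → Bool) := Measure.pi fun _ => bernoulliMeasure true false p with hν
  let good : Set (Fin n → Bool) := {η | (∀ v ∈ I, η v = true) ∧ ∀ v ∈ Q, η v = false}
  have hmap : (sampleLaw n τ).map (MeasurableEquiv.curry (SetIndex n τ) (Fin n) Bool) =
      Measure.pi fun _ : SetIndex n τ => ν := by
    have := Measure.infinitePi_map_curry
      fun (_ : SetIndex n τ) (_ : Fin n) => bernoulliMeasure true false p
    simp only [Measure.infinitePi_eq_pi] at this
    exact this
  have hset : {ω : Sample n τ | ∀ t ∈ T, ¬ ((∀ v ∈ I, v ∈ randomSet ω t) ∧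
      ∀ v ∈ Q, v ∉ randomSet ω t)} = MeasurableEquiv.curry (SetIndex n τ) (Fin n) Bool ⁻¹'
        Set.pi Set.univ fun t => if t ∈ T then goodᶜ else Set.univ := by
    ext ω
    simp only [Set.mem_ofPred_eq, Set.mem_preimage, Set.mem_pi, Set.mem_univ, true_implies]
    refine forall_congr' fun t => ?_
    by_cases ht : t ∈ T
    · simp [ht, good, randomSet, MeasurableEquiv.curry, Function.curry]
    · simp [ht]
  have hfac : ∀ t : SetIndex n τ, ν.real (if t ∈ T then goodᶜ else Set.univ) =
      if t ∈ T then 1 - (p : ℝ) ^ #I * (1 - (p : ℝ)) ^ #Q else 1 := by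
    intro t
    split_ifs
    · rw [probReal_compl_eq_one_sub (Set.toFinite good).measurableSet,
        measureReal_pi_cylinder p h]
    · simp
  rw [hset, ← map_measureReal_apply (MeasurableEquiv.measurable _)
    (Set.toFinite _).measurableSet, hmap, measureReal_def, Measure.pi_pi, ENNReal.toReal_prod]
  simp only [← measureReal_def, hfac]
  simp [prod_ite_mem]

theorem two_le_tauMax (τ : ℕ) : 2 ≤ tauMax τ := le_max_right _ _

/-- This is the square of Bernoulli's inequality `(1 - 1/τ') ^ (τ'/2) ≥ 1/2`. -/
theorem quarter_le_inclusionProb_pow (τ : ℕ) : 1 / 4 ≤ (inclusionProb τ : ℝ) ^ tauMax τ := by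
  have ht : (2 : ℝ) ≤ tauMax τ := by exact_mod_cast two_le_tauMax τ
  have hp : (inclusionProb τ : ℝ) = 1 + -(1 / (tauMax τ : ℝ)) := by
    simp [inclusionProb, sub_eq_add_neg]
  have h1 : 1 / (tauMax τ : ℝ) ≤ 1 := by rw [div_le_one (by linarith)]; linarith
  have hb := one_add_mul_self_le_rpow_one_add (s := -(1 / (tauMax τ : ℝ))) (by linarith)
    (p := (tauMax τ : ℝ) / 2) (by linarith)
  rw [← hp, show 1 + (tauMax τ : ℝ) / 2 * -(1 / (tauMax τ : ℝ)) = 1 / 2 by field_simp; norm_num]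
    at hb
  have h0 : (0 : ℝ) ≤ inclusionProb τ := (inclusionProb τ).2.1
  have hsq : ((inclusionProb τ : ℝ) ^ ((tauMax τ : ℝ) / 2)) ^ 2 =
      (inclusionProb τ : ℝ) ^ tauMax τ := by
    rw [← Real.rpow_mul_natCast h0, ← Real.rpow_natCast]
    congr 1
    push_cast
    ring
  rw [← hsq]
  nlinarith

theorem one_sub_inclusionProb (τ : ℕ) :
    1 - (inclusionProb τ : ℝ) = 1 / (tauMax τ : ℝ) := by
  simp [inclusionProb]

/-- `m` independent trials with success probability at least `q` all fail with probability at most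
`n⁻⁴` once `q m ≥ 4 log n`. -/
theorem one_sub_pow_le {n m : ℕ} (hn : 0 < n) {q q' : ℝ} (hq : q' ≤ q) (hq1 : q ≤ 1)
    (h : 4 * Real.log n ≤ q' * m) : (1 - q) ^ m ≤ 1 / (n : ℝ) ^ 4 := by
  have hn' : (0 : ℝ) < n := by exact_mod_cast hn
  calc (1 - q) ^ m ≤ Real.exp (-q') ^ m :=
        pow_le_pow_left₀ (by linarith) (by linarith [Real.add_one_le_exp (-q')]) _
    _ = Real.exp (-(q' * m)) := by rw [← Real.exp_nat_mul]; ring_nf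
    _ ≤ Real.exp (-(4 * Real.log n)) := Real.exp_le_exp.2 (by linarith)
    _ = 1 / (n : ℝ) ^ 4 := by
        rw [Real.exp_neg, show 4 * Real.log n = ((4 : ℕ) : ℝ) * Real.log n by norm_num,
          Real.exp_nat_mul, Real.exp_log hn', one_div]

theorem fail_edge_le (hn : 2 ≤ n) {T : Finset (SetIndex n τ)} (hT : #T = numEdgeSets n τ)
    {I Q : Finset (Fin n)} (h : Disjoint I Q) (hI : #I ≤ τ + 1) (hQ : #Q ≤ 1) :
    (sampleLaw n τ).real {ω | ∀ t ∈ T, ¬ ((∀ v ∈ I, v ∈ randomSet ω t) ∧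
      ∀ v ∈ Q, v ∉ randomSet ω t)} ≤ 1 / (n : ℝ) ^ 4 := by
  rw [measureReal_forall_not T h]
  have ht : (2 : ℝ) ≤ tauMax τ := by exact_mod_cast two_le_tauMax τ
  have h0 : (0 : ℝ) ≤ inclusionProb τ := (inclusionProb τ).2.1
  have hp1 : (inclusionProb τ : ℝ) ≤ 1 := (inclusionProb τ).2.2
  have hp2 := one_sub_inclusionProb τ
  have hinv : 1 / (tauMax τ : ℝ) ≤ 1 / 2 := one_div_le_one_div_of_le (by norm_num) ht
  have hL : 0 ≤ Real.log n := Real.log_nonneg (by exact_mod_cast (by omega : 1 ≤ n))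
  refine one_sub_pow_le (by omega) (q' := 1 / 4 * (1 / 2) * (1 / (tauMax τ : ℝ))) ?_
    (inclusion_pow_mul_le_one _ _ _) ?_
  · rw [hp2]
    have h1 : (inclusionProb τ : ℝ) ^ (tauMax τ + 1) ≤ (inclusionProb τ : ℝ) ^ #I :=
      pow_le_pow_of_le_one h0 hp1 (hI.trans (by unfold tauMax; omega))
    have h2 : 1 / 4 * (1 / 2) ≤ (inclusionProb τ : ℝ) ^ (tauMax τ + 1) := by
      rw [pow_succ]
      exact mul_le_mul (quarter_le_inclusionProb_pow τ) (by linarith) (by norm_num)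
        (pow_nonneg h0 _)
    have h3 : (1 / (tauMax τ : ℝ)) ^ 1 ≤ (1 / (tauMax τ : ℝ)) ^ #Q :=
      pow_le_pow_of_le_one (by positivity) (by linarith) hQ
    rw [pow_one] at h3
    exact mul_le_mul (h2.trans h1) h3 (by positivity) (pow_nonneg h0 _)
  · rw [hT]
    have h1 : 72 * (tauMax τ : ℝ) * Real.log n ≤ numEdgeSets n τ := Nat.le_ceil _
    calc 4 * Real.log n ≤ 9 * Real.log n := by linarith
      _ = 1 / 4 * (1 / 2) * (1 / (tauMax τ : ℝ)) * (72 * (tauMax τ : ℝ) * Real.log n) := by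
          field_simp; ring
      _ ≤ _ := by gcongr

theorem fail_nonEdge_le (hn : 2 ≤ n) {T : Finset (SetIndex n τ)} (hT : #T = numNonEdgeSets n τ)
    {I Q : Finset (Fin n)} (h : Disjoint I Q) (hI : #I ≤ τ) (hQ : #Q ≤ 2) :
    (sampleLaw n τ).real {ω | ∀ t ∈ T, ¬ ((∀ v ∈ I, v ∈ randomSet ω t) ∧
      ∀ v ∈ Q, v ∉ randomSet ω t)} ≤ 1 / (n : ℝ) ^ 4 := by
  rw [measureReal_forall_not T h]
  have ht : (2 : ℝ) ≤ tauMax τ := by exact_mod_cast two_le_tauMax τ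
  have h0 : (0 : ℝ) ≤ inclusionProb τ := (inclusionProb τ).2.1
  have hp1 : (inclusionProb τ : ℝ) ≤ 1 := (inclusionProb τ).2.2
  have hp2 := one_sub_inclusionProb τ
  have hinv : 1 / (tauMax τ : ℝ) ≤ 1 / 2 := one_div_le_one_div_of_le (by norm_num) ht
  have hL : 0 ≤ Real.log n := Real.log_nonneg (by exact_mod_cast (by omega : 1 ≤ n))
  refine one_sub_pow_le (by omega) (q' := 1 / 4 * (1 / (tauMax τ : ℝ)) ^ 2) ?_
    (inclusion_pow_mul_le_one _ _ _) ?_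
  · rw [hp2]
    have h1 : (inclusionProb τ : ℝ) ^ tauMax τ ≤ (inclusionProb τ : ℝ) ^ #I :=
      pow_le_pow_of_le_one h0 hp1 (hI.trans (by unfold tauMax; omega))
    have h3 : (1 / (tauMax τ : ℝ)) ^ 2 ≤ (1 / (tauMax τ : ℝ)) ^ #Q :=
      pow_le_pow_of_le_one (by positivity) (by linarith) hQ
    exact mul_le_mul ((quarter_le_inclusionProb_pow τ).trans h1) h3 (by positivity)
      (pow_nonneg h0 _)
  · rw [hT]
    have h1 : 24 * (tauMax τ : ℝ) ^ 2 * Real.log n ≤ numNonEdgeSets n τ := Nat.le_ceil _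
    calc 4 * Real.log n ≤ 6 * Real.log n := by linarith
      _ = 1 / 4 * (1 / (tauMax τ : ℝ)) ^ 2 * (24 * (tauMax τ : ℝ) ^ 2 * Real.log n) := by
          field_simp; ring
      _ ≤ _ := by gcongr

variable {G : LatentGraph n}

/-- With high probability every pair of observables has, in each of the three collections, a set
that contains its `p`-colliders and separates the pair in the required way. -/
theorem one_sub_le_measureReal_good (hn : 2 ≤ n) (hτ : G.IsTauCausal τ) :
    1 - 3 / (n : ℝ) ^ 2 ≤ (sampleLaw n τ).real {ω |
      (∀ i j, i ≠ j → ∃ S ∈ collA ω, i ∈ S ∧ j ∉ S ∧ ∀ k, G.IsPCollider i j k → k ∈ S) ∧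
      (∀ i j, i ≠ j → ∃ S ∈ collD ω, i ∉ S ∧ j ∉ S ∧ ∀ k, G.IsPCollider i j k → k ∈ S) ∧
      ∀ i j, i ≠ j → ∃ S ∈ collB ω, i ∈ S ∧ j ∉ S ∧ ∀ k, G.IsPCollider i j k → k ∈ S} := by
  classical
  let F : Finset (SetIndex n τ) → Finset (Fin n) → Finset (Fin n) → Set (Sample n τ) :=
    fun T I Q => {ω | ∀ t ∈ T, ¬ ((∀ v ∈ I, v ∈ randomSet ω t) ∧ ∀ v ∈ Q, v ∉ randomSet ω t)}
  let TA : Finset (SetIndex n τ) := univ.image Sum.inl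
  let TD : Finset (SetIndex n τ) := univ.image fun t => Sum.inr (Sum.inl t)
  let TB : Finset (SetIndex n τ) := univ.image fun t => Sum.inr (Sum.inr t)
  have hTA : #TA = numEdgeSets n τ := by
    rw [card_image_of_injective _ Sum.inl_injective]; simp
  have hTD : #TD = numNonEdgeSets n τ := by
    rw [card_image_of_injective _ fun a b h => Sum.inl_injective (Sum.inr_injective h)]; simp
  have hTB : #TB = numEdgeSets n τ := by
    rw [card_image_of_injective _ fun a b h => Sum.inr_injective (Sum.inr_injective h)]; simp
  let K : Fin n → Fin n → Finset (Fin n) := fun i j => univ.filter fun k => G.IsPCollider i j k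
  have hK : ∀ i j, i ≠ j → #(K i j) ≤ τ := by
    intro i j hij
    have := hτ i j hij
    rwa [Set.ncard_eq_toFinset_card', show Set.toFinset {k | G.IsPCollider i j k} = K i j by
      ext; simp [K]] at this
  have hKi : ∀ i j, i ∉ K i j := fun i j h => (notMem_of_isPCollider (mem_filter.1 h).2).1 rfl
  have hKj : ∀ i j, j ∉ K i j := fun i j h => (notMem_of_isPCollider (mem_filter.1 h).2).2 rfl
  let bad : Fin n × Fin n → Set (Sample n τ) := fun q =>
    if q.1 = q.2 then ∅ else
      F TA (insert q.1 (K q.1 q.2)) {q.2} ∪ F TD (K q.1 q.2) {q.1, q.2} ∪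
        F TB (insert q.1 (K q.1 q.2)) {q.2}
  have hn0 : (0 : ℝ) < n := by exact_mod_cast (by omega : 0 < n)
  have hbad : ∀ q, (sampleLaw n τ).real (bad q) ≤ 3 / (n : ℝ) ^ 4 := by
    rintro ⟨i, j⟩
    by_cases hij : i = j
    · simp only [bad, hij, if_true, measureReal_empty]
      positivity
    simp only [bad, hij, if_false]
    have hd1 : Disjoint (insert i (K i j)) {j} := by
      rw [disjoint_singleton_right, mem_insert, not_or]
      exact ⟨fun h => hij h.symm, hKj i j⟩
    have hd2 : Disjoint (K i j) {i, j} := by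
      rw [disjoint_insert_right, disjoint_singleton_right]
      exact ⟨hKi i j, hKj i j⟩
    have hc := (card_insert_le i (K i j)).trans (Nat.succ_le_succ (hK i j hij))
    have h1 := fail_edge_le hn hTA hd1 hc (by simp)
    have h2 := fail_nonEdge_le hn hTD hd2 (hK i j hij) card_le_two
    have h3 := fail_edge_le hn hTB hd1 hc (by simp)
    refine (measureReal_union_le _ _).trans
      ((add_le_add (measureReal_union_le _ _) le_rfl).trans ?_)
    refine (add_le_add (add_le_add h1 h2) h3).trans (le_of_eq ?_)
    ring
  have hunion : (sampleLaw n τ).real (⋃ q, bad q) ≤ 3 / (n : ℝ) ^ 2 := by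
    refine (measureReal_iUnion_fintype_le _).trans ((sum_le_sum fun q _ => hbad q).trans ?_)
    rw [sum_const, card_univ, Fintype.card_prod, Fintype.card_fin, nsmul_eq_mul]
    apply le_of_eq
    push_cast
    field_simp
  have hcompl := probReal_compl_eq_one_sub (μ := sampleLaw n τ)
    (Set.toFinite (⋃ q, bad q)).measurableSet
  refine le_trans (by rw [hcompl]; linarith) (measureReal_mono (s₁ := (⋃ q, bad q)ᶜ) ?_)
  intro ω hω
  simp only [Set.mem_compl_iff, Set.mem_iUnion, not_exists] at hω
  have key : ∀ i j, i ≠ j →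
      (∃ t ∈ TA, i ∈ randomSet ω t ∧ j ∉ randomSet ω t ∧
        ∀ k, G.IsPCollider i j k → k ∈ randomSet ω t) ∧
      (∃ t ∈ TD, i ∉ randomSet ω t ∧ j ∉ randomSet ω t ∧
        ∀ k, G.IsPCollider i j k → k ∈ randomSet ω t) ∧
      ∃ t ∈ TB, i ∈ randomSet ω t ∧ j ∉ randomSet ω t ∧
        ∀ k, G.IsPCollider i j k → k ∈ randomSet ω t := by
    intro i j hij
    have h := hω (i, j)
    simp only [bad, hij, if_false, Set.mem_union, not_or, F, Set.mem_ofPred_eq] at h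
    push Not at h
    obtain ⟨⟨⟨t, ht, h1, h2⟩, ⟨t', ht', h1', h2'⟩⟩, ⟨t'', ht'', h1'', h2''⟩⟩ := h
    have hKm : ∀ k, G.IsPCollider i j k → k ∈ K i j := fun k hk =>
      mem_filter.2 ⟨mem_univ _, hk⟩
    exact ⟨⟨t, ht, h1 i (mem_insert_self _ _), h2 j (by simp),
        fun k hk => h1 k (mem_insert_of_mem (hKm k hk))⟩,
      ⟨t', ht', h2' i (by simp), h2' j (by simp), fun k hk => h1' k (hKm k hk)⟩,
      ⟨t'', ht'', h1'' i (mem_insert_self _ _), h2'' j (by simp),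
        fun k hk => h1'' k (mem_insert_of_mem (hKm k hk))⟩⟩
  refine ⟨fun i j hij => ?_, fun i j hij => ?_, fun i j hij => ?_⟩
  · obtain ⟨t, ht, h⟩ := (key i j hij).1
    obtain ⟨s, -, rfl⟩ := mem_image.1 ht
    exact ⟨_, mem_image_of_mem _ (mem_univ s), h⟩
  · obtain ⟨t, ht, h⟩ := (key i j hij).2.1
    obtain ⟨s, -, rfl⟩ := mem_image.1 ht
    exact ⟨_, mem_image_of_mem _ (mem_univ s), h⟩
  · obtain ⟨t, ht, h⟩ := (key i j hij).2.2
    obtain ⟨s, -, rfl⟩ := mem_image.1 ht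
    exact ⟨_, mem_image_of_mem _ (mem_univ s), h⟩

end Random

end CausalRecovery

theorem mainTheorem1 :
    ∃ C : ℝ, 0 < C ∧ ∀ (n τ : ℕ), τ + 2 ≤ n →
      ∀ (G : CausalRecovery.LatentGraph n), G.IsCausal → G.IsTauCausal τ →
      ∀ (M : CausalRecovery.CausalModel G), M.IsFaithful → M.IsDoSeeFaithful →
        (∀ ω : CausalRecovery.Sample n τ,
          ((CausalRecovery.interventions M.oracles (CausalRecovery.collA ω)
            (CausalRecovery.collD ω) (CausalRecovery.collB ω)).card : ℝ) ≤
              C * (n * τ * Real.log n + n * Real.log n) ∧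
          ∀ O : CausalRecovery.Oracles n,
            CausalRecovery.Oracles.AgreeOn
              (CausalRecovery.interventions M.oracles (CausalRecovery.collA ω)
                (CausalRecovery.collD ω) (CausalRecovery.collB ω)) M.oracles O →
            CausalRecovery.recoverGraph O (CausalRecovery.collA ω) (CausalRecovery.collD ω)
                (CausalRecovery.collB ω) =
              CausalRecovery.recoverGraph M.oracles (CausalRecovery.collA ω)
                (CausalRecovery.collD ω) (CausalRecovery.collB ω)) ∧
        1 - C / (n : ℝ) ^ 2 ≤
          (CausalRecovery.sampleLaw n τ).real
            {ω | CausalRecovery.recoverGraph M.oracles (CausalRecovery.collA ω)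
              (CausalRecovery.collD ω) (CausalRecovery.collB ω) = G} := by
  refine ⟨1000, by norm_num, fun n τ hn G hG hτ M hM hM' => ⟨fun ω => ⟨?_, fun O hO => ?_⟩, ?_⟩⟩
  · exact CausalRecovery.card_le_mul_log hn M.oracles ω
  · exact CausalRecovery.recoverGraph_congr hO
  · refine le_trans ?_ ((CausalRecovery.one_sub_le_measureReal_good (by omega) hτ).trans
      (measureReal_mono ?_))
    · gcongr
      norm_num
    · rintro ω ⟨hA, hD, hB⟩
      exact CausalRecovery.recoverGraph_eq hG hM hM' hA hD hB
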